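/- Let $\mu$ be a finite positive Borel measure on the unit circle $\mathbb{T}$ with infinite support, let $\mathfrak{q}\in\mathbb{C}$, and for $t\in\mathbb{R}$ let $d\mu^{(t)}(z)=e^{-t(\overline{\mathfrak q}z+\mathfrak q/z)}\,d\mu(z)$, which is again a positive measure. Let $\Phi_n(\cdot;t)$ and $\varphi_n(\cdot;t)$ be the monic orthogonal and the orthonormal polynomials of $\mu^{(t)}$, $\Phi_n^*(z;t)=z^n\overline{\Phi_n(1/\bar z;t)}$, $\mathfrak a_n(t)=-\overline{\Phi_{n+1}(0;t)}$ and $\rho_n(t)=\Phi_n(1;t)/\Phi_n^*(1;t)$ for $n\ge 0$, and $K_n^{(t)}(z,1)=\sum_{j=0}^n\overline{\varphi_j(1;t)}\varphi_j(z;t)$. Put \[ g_n=\frac12\,\frac{|1-\rho_{n-1}\mathfrak a_{n-1}|^2}{1-\Re(\rho_{n-1}\mathfrak a_{n-1})}\ (n\ge1),\qquad \xi_n=\mu^{(t)}(\mathbb T)\prod_{j=1}^n(1-g_j),\qquad R_n(z;t)=2^n\,\xi_n(t)\,K_n^{(t)}(z,1)\ (n\ge 0), \] \[ c_n=\frac{\Im(\rho_{n-1}\mathfrak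 a_{n-1})}{\Re(\rho_{n-1}\mathfrak a_{n-1})-1}\in\mathbb R,\qquad d_{n+1}=(1-g_n)\,g_{n+1}\in\mathbb R\quad(n\ge1),\qquad c_0=1,\quad d_1=0 . \] Then the following hold. (i) For all $t\in\mathbb R$ and $n\ge0$, $R_n(z;t)=Q_n(z;t)\prod_{k=1}^n(1+ic_k(t))$, where $Q_n(\cdot;t)$ is a monic polynomial of degree $n$ with $\mathcal L^{(t)}[z^{-n+s}Q_n(z;t)]=0$ for $0\le s\le n-1$ and \[ \mathcal L^{(t)}[f]=\int_{\mathbb T} f(z)\,(z-1)\,e^{-t(\overline{\mathfrak q}z+\mathfrak q/z)}\,d\mu(z). \] (ii) For every $t$, $R_0=1$, $R_1=(1+ic_1)z+(1-ic_1)$ and \[ R_{n+1}(z;t)=[(1+ic_{n+1}(t))z+(1-ic_{n+1}(t))]R_n(z;t)-4d_{n+1}(t)\,z\,R_{n-1}(z;t),\qquad n\ge1, \] and the real numbers $c_n(t)$ ($n\ge1$), $d_n(t)$ ($n\ge2$) are uniquely determined by these relations. (iii) For all $t\in\mathbb R$ the coefficients are differentiable in $t$ and \[ \dot c_1=-4\Re(\mathfrak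 q)\,\frac{d_2(c_1+c_2)}{1+c_2^2}-4\Im(\mathfrak q)\,\frac{d_2(1-c_1c_2)}{1+c_2^2}, \] and, for $n\ge2$, \[ \dot c_n=4\Re(\mathfrak q)\left[\frac{d_n(c_n+c_{n-1})}{1+c_{n-1}^2}-\frac{d_{n+1}(c_n+c_{n+1})}{1+c_{n+1}^2}\right]+4\Im(\mathfrak q)\left[\frac{d_n(1-c_nc_{n-1})}{1+c_{n-1}^2}-\frac{d_{n+1}(1-c_nc_{n+1})}{1+c_{n+1}^2}\right], \] \[ \dot d_n=4\Re(\mathfrak q)\left[\frac{d_nd_{n-1}}{1+c_{n-2}^2}-\frac{d_nd_{n+1}}{1+c_{n+1}^2}+\frac{d_n(1-d_n)(c_{n-1}^2-c_n^2)}{(1+c_n^2)(1+c_{n-1}^2)}\right]-4\Im(\mathfrak q)\left[\frac{d_nd_{n-1}c_{n-2}}{1+c_{n-2}^2}-\frac{d_nd_{n+1}c_{n+1}}{1+c_{n+1}^2}+\frac{d_n(1-d_n)(c_n-c_{n-1})(1-c_nc_{n-1})}{(1+c_n^2)(1+c_{n-1}^2)}\right]. \] -/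

import Mathlib

open MeasureTheory Polynomial ComplexConjugate

namespace CircleKernel

noncomputable section

/-- The modified measure `e^{-t (conj q * z + q / z)} dμ(z)`. On the unit circle `q / z` is the
complex conjugate of `conj q * z`, so that the exponent is real. -/
def modifiedMeasure (μ : Measure ℂ) (q : ℂ) (t : ℝ) : Measure ℂ :=
  μ.withDensity fun z => ENNReal.ofReal (Real.exp (-t * (conj q * z + q / z).re))

/-- The functional `f ↦ ∫ f(z) (z - 1) e^{-t (conj q * z + q / z)} dμ(z)`. -/
def momentFunctional (μ : Measure ℂ) (q : ℂ) (t : ℝ) (f : ℂ → ℂ) : ℂ :=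
  ∫ z, f z * (z - 1) * Complex.exp (-(t : ℂ) * (conj q * z + q / z)) ∂μ

/-- `Q` is a monic L-orthogonal polynomial of degree `n` for the functional `L`:
`L [z ^ (-n + s) Q(z)] = 0` for `s = 0, 1, ..., n - 1`. -/
def IsMonicLOrthogonal (L : (ℂ → ℂ) → ℂ) (n : ℕ) (Q : ℂ[X]) : Prop :=
  Q.Monic ∧ Q.natDegree = n ∧
    ∀ s : ℕ, s < n → L (fun z => z ^ (-(n : ℤ) + (s : ℤ)) * Q.eval z) = 0

/-- The inner product `∫ p(z) conj (r(z)) dν(z)` of two polynomials. -/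
def polyInner (ν : Measure ℂ) (p r : ℂ[X]) : ℂ :=
  ∫ z, p.eval z * conj (r.eval z) ∂ν

/-- The monic orthogonal polynomials `Φ_n` of `ν`, obtained by orthogonalizing
`1, z, z ^ 2, ...` successively. -/
def monicOP (ν : Measure ℂ) (n : ℕ) : ℂ[X] :=
  X ^ n - ∑ k : Fin n,
    C (polyInner ν (X ^ n) (monicOP ν k) / polyInner ν (monicOP ν k) (monicOP ν k)) * monicOP ν k
termination_by n
decreasing_by all_goals exact k.2

/-- The orthonormal polynomials `φ_n = Φ_n / ‖Φ_n‖`. -/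
def orthonormalOP (ν : Measure ℂ) (n : ℕ) : ℂ[X] :=
  C (((Real.sqrt (∫ z, ‖(monicOP ν n).eval z‖ ^ 2 ∂ν))⁻¹ : ℝ) : ℂ) * monicOP ν n

/-- The reciprocal polynomial `Φ_n^*(z) = z ^ n conj (Φ_n (1 / conj z))`. -/
def reciprocalOP (ν : Measure ℂ) (n : ℕ) : ℂ[X] :=
  ((monicOP ν n).map (starRingEnd ℂ)).reflect n

/-- The Verblunsky coefficients `a_n = - conj (Φ_{n+1}(0))`, `n ≥ 0`. -/
def verblunsky (ν : Measure ℂ) (n : ℕ) : ℂ :=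
  -conj ((monicOP ν (n + 1)).eval 0)

/-- The ratio `ρ_n = Φ_n(1) / Φ_n^*(1)`. -/
def rho (ν : Measure ℂ) (n : ℕ) : ℂ :=
  (monicOP ν n).eval 1 / (reciprocalOP ν n).eval 1

/-- The Christoffel-Darboux kernel `K_n(z, w) = ∑_{j ≤ n} conj (φ_j(w)) φ_j(z)`, as a polynomial
in `z`. -/
def cdKernel (ν : Measure ℂ) (n : ℕ) (w : ℂ) : ℂ[X] :=
  ∑ j ∈ Finset.range (n + 1), C (conj ((orthonormalOP ν j).eval w)) * orthonormalOP ν j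

/-- The parameters `g_n`, for `n ≥ 1` (the value at `0` is not used). -/
def gParam (ν : Measure ℂ) : ℕ → ℝ
  | 0 => 0
  | n + 1 => 1 / 2 * (‖1 - rho ν n * verblunsky ν n‖ ^ 2 / (1 - (rho ν n * verblunsky ν n).re))

/-- `ξ_n = ξ_0 ∏_{j=1}^n (1 - g_j)` with `ξ_0` the total mass of `ν`. -/
def xi (ν : Measure ℂ) (n : ℕ) : ℝ :=
  ν.real Set.univ * ∏ j ∈ Finset.Icc 1 n, (1 - gParam ν j)

/-- The normalized Christoffel-Darboux kernels `R_n(z) = 2 ^ n ξ_n K_n(z, 1)`. -/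
def normalizedKernel (ν : Measure ℂ) (n : ℕ) : ℂ[X] :=
  C ((2 ^ n * xi ν n : ℝ) : ℂ) * cdKernel ν n 1

/-- The coefficients `c_n`, with the convention `c_0 = 1`. -/
def cCoeff (ν : Measure ℂ) : ℕ → ℝ
  | 0 => 1
  | n + 1 => (rho ν n * verblunsky ν n).im / ((rho ν n * verblunsky ν n).re - 1)

/-- The coefficients `d_{n+1} = (1 - g_n) g_{n+1}` for `n ≥ 1`, with the convention `d_1 = 0`
(the value at `0` is not used). -/
def dCoeff (ν : Measure ℂ) : ℕ → ℝ
  | 0 => 0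
  | 1 => 0
  | n + 2 => (1 - gParam ν (n + 1)) * gParam ν (n + 2)

/-- The polynomials `R_n` satisfy `R_0 = 1`, `R_1 = (1 + i c_1) z + (1 - i c_1)` and, for `n ≥ 1`,
`R_{n+1} = [(1 + i c_{n+1}) z + (1 - i c_{n+1})] R_n - 4 d_{n+1} z R_{n-1}`. -/
def SatisfiesRecurrence (R : ℕ → ℂ[X]) (c d : ℕ → ℝ) : Prop :=
  R 0 = 1 ∧
  R 1 = C (1 + Complex.I * (c 1 : ℂ)) * X + C (1 - Complex.I * (c 1 : ℂ)) ∧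
  ∀ n : ℕ, 1 ≤ n →
    R (n + 1) =
      (C (1 + Complex.I * (c (n + 1) : ℂ)) * X + C (1 - Complex.I * (c (n + 1) : ℂ))) * R n
        - C (4 * (d (n + 1) : ℂ)) * X * R (n - 1)

end

end CircleKernel

open CircleKernel

/-!
Write `Φ_n`, `a_n`, `ρ_n` for the monic orthogonal polynomials, the Verblunsky coefficients and the
ratios `Φ_n(1) / Φ_n^*(1)` of a measure on the unit circle with infinite support. Everything is
expressed through the rotated Verblunsky coefficients `b_n = ρ_n a_n`, which lie in the open unit
disc: `1 + i c_{n+1} = (1 - b_n) / (1 - Re b_n)` and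
`1 - g_{n+1} = (1 - |b_n|²) / (2 (1 - Re b_n))`, equivalently
`b_n = 1 - 2 g_{n+1} / (1 - i c_{n+1})`.

At a fixed time, the Szegő recurrence (`monicOP_succ`, `reciprocalOP_succ`) gives
`Φ_{n+1}(1) = (1 - conj b_n) Φ_n(1)` and a three term recurrence for the numerators
`Φ_n(1) Φ_n^* - conj (Φ_n(1)) z Φ_n` of the Christoffel-Darboux formula for `K_n(z, 1)`
(`cdNumerator_add_two`, `one_sub_X_mul_cdKernel`). As `2 ^ n ξ_n ∏_{j<n} (1 - Re b_j) = ‖Φ_n‖²`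
(`two_pow_mul_xi`), division by `(1 - z) ∏_{j<n} (1 - Re b_j)` turns this into the recurrence of
the `R_n` (`satisfiesRecurrence_normalizedKernel`). The L-orthogonality is the reproducing property
of the kernel applied to polynomials that vanish at `1` (`isMonicLOrthogonal_normalizedKernel`).

For the dependence on `t`, differentiating the relations `⟨Φ_{n+1}, z ^ k⟩_t = 0`, `k ≤ n`, under
the integral sign yields
`dΦ_{n+1}/dt = (1 - |a_n|²) (q Φ_n + conj q * conj a_{n+1} * Φ_n^*)`
(`hasDerivAt_coeff_monicOP_succ`). Its values at `0` and `1` give the Schur flow for `a_n` and the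
motion of `ρ_n`, hence a closed differential equation for `b_n` in terms of its neighbours
(`rotFlow`, `hasDerivAt_rotVerblunsky_succ`); the first equation has the same form with
`b_{-1} = -1`. In the real parameters this becomes `ċ_n = cFlow` and `ġ_n = gFlow`
(`hasDerivAt_params`), and `d_{n+1} = (1 - g_n) g_{n+1}` follows by the product rule.
-/

/-! ### The inner product of polynomials on the unit circle -/

lemma mul_conj_eq_one {z : ℂ} (hz : ‖z‖ = 1) : z * conj z = 1 := by
  rw [Complex.mul_conj, Complex.normSq_eq_norm_sq, hz]
  simp

lemma conj_polyInner {ν : Measure ℂ} (p r : ℂ[X]) : conj (polyInner ν p r) = polyInner ν r p := by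
  unfold polyInner
  rw [← integral_conj]
  congr 1
  ext z
  simp [mul_comm]

lemma polyInner_C_mul_left {ν : Measure ℂ} (a : ℂ) (p r : ℂ[X]) :
    polyInner ν (C a * p) r = a * polyInner ν p r := by
  unfold polyInner
  rw [← integral_const_mul]
  simp [mul_assoc]

lemma degree_C_mul_lt {p : ℂ[X]} {n : WithBot ℕ} (h : p.degree < n) (a : ℂ) :
    (C a * p).degree < n := by
  rw [← smul_eq_C_mul]
  exact (degree_smul_le a p).trans_lt h

/-- Multiplication by `z` is an isometry of `L²` of a measure on the unit circle. -/
lemma polyInner_X_mul_X_mul {ν : Measure ℂ} (hc : ∀ᵐ z ∂ν, ‖z‖ = 1)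
    (p r : ℂ[X]) :
    polyInner ν (X * p) (X * r) = polyInner ν p r := by
  unfold polyInner
  refine integral_congr_ae ?_
  filter_upwards [hc] with z hz
  have h1 : z * conj z = 1 := mul_conj_eq_one hz
  simp only [eval_mul, eval_X, map_mul]
  linear_combination (p.eval z * conj (r.eval z)) * h1

lemma polyInner_self {ν : Measure ℂ} (p : ℂ[X]) :
    polyInner ν p p = ((∫ z, ‖p.eval z‖ ^ 2 ∂ν : ℝ) : ℂ) := by
  unfold polyInner
  rw [← integral_complex_ofReal]
  congr 1
  ext z
  rw [Complex.mul_conj, Complex.normSq_eq_norm_sq]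

lemma polyInner_C_mul_right {ν : Measure ℂ} (a : ℂ) (p r : ℂ[X]) :
    polyInner ν p (C a * r) = conj a * polyInner ν p r := by
  simp only [← conj_polyInner _ p, polyInner_C_mul_left, map_mul]

section InnerProduct

variable {ν : Measure ℂ} [IsFiniteMeasure ν]

lemma integrable_of_continuous_of_ae_circle (hc : ∀ᵐ z ∂ν, ‖z‖ = 1) {f : ℂ → ℂ}
    (hf : Continuous f) : Integrable f ν := by
  obtain ⟨M, hM⟩ := (isCompact_sphere (0 : ℂ) 1).exists_bound_of_continuousOn hf.continuousOn
  refine Integrable.of_bound hf.aestronglyMeasurable M ?_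
  filter_upwards [hc] with z hz
  exact hM z (by simpa using hz)

lemma integrable_polyInner (hc : ∀ᵐ z ∂ν, ‖z‖ = 1) (p r : ℂ[X]) :
    Integrable (fun z => p.eval z * conj (r.eval z)) ν :=
  integrable_of_continuous_of_ae_circle hc
    (p.continuous.mul (Complex.continuous_conj.comp r.continuous))

lemma polyInner_add_left (hc : ∀ᵐ z ∂ν, ‖z‖ = 1) (p₁ p₂ r : ℂ[X]) :
    polyInner ν (p₁ + p₂) r = polyInner ν p₁ r + polyInner ν p₂ r := by
  unfold polyInner
  rw [← integral_add (integrable_polyInner hc _ _) (integrable_polyInner hc _ _)]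
  simp [add_mul]

lemma polyInner_sub_left (hc : ∀ᵐ z ∂ν, ‖z‖ = 1) (p₁ p₂ r : ℂ[X]) :
    polyInner ν (p₁ - p₂) r = polyInner ν p₁ r - polyInner ν p₂ r := by
  unfold polyInner
  rw [← integral_sub (integrable_polyInner hc _ _) (integrable_polyInner hc _ _)]
  simp [sub_mul]

lemma polyInner_sum_left (hc : ∀ᵐ z ∂ν, ‖z‖ = 1) {ι : Type*} (s : Finset ι) (p : ι → ℂ[X])
    (r : ℂ[X]) : polyInner ν (∑ i ∈ s, p i) r = ∑ i ∈ s, polyInner ν (p i) r := by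
  unfold polyInner
  rw [← integral_finsetSum _ fun i _ => integrable_polyInner hc _ _]
  simp [eval_finsetSum, Finset.sum_mul]

lemma polyInner_sub_right (hc : ∀ᵐ z ∂ν, ‖z‖ = 1) (p r₁ r₂ : ℂ[X]) :
    polyInner ν p (r₁ - r₂) = polyInner ν p r₁ - polyInner ν p r₂ := by
  simp only [← conj_polyInner _ p, polyInner_sub_left hc, map_sub]

lemma polyInner_sum_right (hc : ∀ᵐ z ∂ν, ‖z‖ = 1) {ι : Type*} (s : Finset ι) (p : ℂ[X])
    (r : ι → ℂ[X]) : polyInner ν p (∑ i ∈ s, r i) = ∑ i ∈ s, polyInner ν p (r i) := by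
  simp only [← conj_polyInner _ p, polyInner_sum_left hc, map_sum]

/-- A nonzero polynomial has positive `L²` norm with respect to a measure on the unit circle with
infinite support, because it vanishes on a finite set only. -/
lemma integral_norm_sq_eval_pos (hc : ∀ᵐ z ∂ν, ‖z‖ = 1) (hs : ν.support.Infinite) {p : ℂ[X]}
    (hp : p ≠ 0) : 0 < ∫ z, ‖p.eval z‖ ^ 2 ∂ν := by
  have hint : Integrable (fun z => ‖p.eval z‖ ^ 2) ν := by
    have := (integrable_polyInner hc p p).norm
    simpa [sq] using this
  refine lt_of_le_of_ne (integral_nonneg fun z => by positivity) fun h => ?_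
  rw [eq_comm, integral_eq_zero_iff_of_nonneg (fun z => by positivity) hint] at h
  refine hs ((p.roots.toFinset.finite_toSet).subset ?_)
  refine Measure.support_subset_of_isClosed p.roots.toFinset.finite_toSet.isClosed ?_
  filter_upwards [h] with z hz
  simpa [hp] using hz

lemma polyInner_self_ne_zero (hc : ∀ᵐ z ∂ν, ‖z‖ = 1) (hs : ν.support.Infinite) {p : ℂ[X]}
    (hp : p ≠ 0) : polyInner ν p p ≠ 0 := by
  rw [polyInner_self]
  exact_mod_cast (integral_norm_sq_eval_pos hc hs hp).ne'

lemma polyInner_eq_sum_coeff_left (hc : ∀ᵐ z ∂ν, ‖z‖ = 1) {p : ℂ[X]} {n : ℕ}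
    (hp : p.natDegree < n) (r : ℂ[X]) :
    polyInner ν p r = ∑ i ∈ Finset.range n, p.coeff i * polyInner ν (X ^ i) r := by
  conv_lhs => rw [p.as_sum_range_C_mul_X_pow' hp]
  rw [polyInner_sum_left hc]
  simp only [polyInner_C_mul_left]

lemma polyInner_eq_sum_coeff_right (hc : ∀ᵐ z ∂ν, ‖z‖ = 1) (p : ℂ[X]) {r : ℂ[X]} {n : ℕ}
    (hr : r.natDegree < n) :
    polyInner ν p r = ∑ i ∈ Finset.range n, conj (r.coeff i) * polyInner ν p (X ^ i) := by
  conv_lhs => rw [r.as_sum_range_C_mul_X_pow' hr]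
  rw [polyInner_sum_right hc]
  simp only [polyInner_C_mul_right]

/-- A polynomial of degree `< n` orthogonal to `1, z, ..., z ^ (n - 1)` is zero. -/
lemma eq_zero_of_polyInner_X_pow_eq_zero (hc : ∀ᵐ z ∂ν, ‖z‖ = 1) (hs : ν.support.Infinite)
    {p : ℂ[X]} {n : ℕ} (hp : p.degree < n) (h : ∀ k < n, polyInner ν p (X ^ k) = 0) : p = 0 := by
  by_contra hp0
  refine polyInner_self_ne_zero hc hs hp0 ?_
  rw [polyInner_eq_sum_coeff_right hc p ((natDegree_lt_iff_degree_lt hp0).2 hp)]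
  exact Finset.sum_eq_zero fun i hi => by rw [h i (Finset.mem_range.1 hi), mul_zero]

end InnerProduct

/-! ### Monic orthogonal polynomials and the Szegő recurrence -/

lemma monicOP_eq (ν : Measure ℂ) (n : ℕ) :
    monicOP ν n = X ^ n - ∑ k : Fin n, C (polyInner ν (X ^ n) (monicOP ν k) /
      polyInner ν (monicOP ν k) (monicOP ν k)) * monicOP ν k := by
  rw [monicOP]

lemma degree_monicOP (ν : Measure ℂ) (n : ℕ) : (monicOP ν n).degree = n := by
  induction n using Nat.strong_induction_on with
  | _ n ih =>
    rw [monicOP_eq, degree_sub_eq_left_of_degree_lt, degree_X_pow]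
    rw [degree_X_pow]
    refine (degree_sum_le _ _).trans_lt ((Finset.sup_lt_iff (WithBot.bot_lt_coe n)).2 fun k _ => ?_)
    refine degree_C_mul_lt ?_ _
    rw [ih k k.2]
    exact Nat.cast_lt.2 k.2

lemma natDegree_monicOP (ν : Measure ℂ) (n : ℕ) : (monicOP ν n).natDegree = n :=
  natDegree_eq_of_degree_eq_some (degree_monicOP ν n)

lemma monicOP_ne_zero (ν : Measure ℂ) (n : ℕ) : monicOP ν n ≠ 0 := by
  intro h
  simpa [h] using degree_monicOP ν n

lemma monic_monicOP (ν : Measure ℂ) (n : ℕ) : (monicOP ν n).Monic := by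
  rw [monicOP_eq]
  refine (monic_X_pow n).sub_of_left ?_
  rw [degree_X_pow]
  refine (degree_sum_le _ _).trans_lt ((Finset.sup_lt_iff (WithBot.bot_lt_coe n)).2 fun k _ => ?_)
  refine degree_C_mul_lt ?_ _
  rw [degree_monicOP]
  exact Nat.cast_lt.2 k.2

lemma coeff_monicOP_self (ν : Measure ℂ) (n : ℕ) : (monicOP ν n).coeff n = 1 := by
  have h := monic_monicOP ν n
  rwa [Monic, leadingCoeff, natDegree_monicOP] at h

@[simp] lemma monicOP_zero (ν : Measure ℂ) : monicOP ν 0 = 1 := by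
  rw [monicOP_eq]; simp

@[simp] lemma reciprocalOP_zero (ν : Measure ℂ) : reciprocalOP ν 0 = 1 := by
  simp [reciprocalOP, reflect_one]

lemma natDegree_reciprocalOP_le (ν : Measure ℂ) (n : ℕ) :
    (reciprocalOP ν n).natDegree ≤ n := by
  refine natDegree_reflect_le.trans ?_
  rw [natDegree_map, natDegree_monicOP, max_self]

lemma eval_zero_reciprocalOP (ν : Measure ℂ) (n : ℕ) : (reciprocalOP ν n).eval 0 = 1 := by
  rw [← coeff_zero_eq_eval_zero, reciprocalOP, coeff_reflect, revAt_le (Nat.zero_le n), coeff_map,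
    Nat.sub_zero, coeff_monicOP_self, map_one]

lemma eval_reciprocalOP_of_norm_eq_one (ν : Measure ℂ) (n : ℕ) {z : ℂ} (hz : ‖z‖ = 1) :
    (reciprocalOP ν n).eval z = z ^ n * conj ((monicOP ν n).eval z) := by
  have h1 : z * conj z = 1 := mul_conj_eq_one hz
  let : Invertible (conj z) := ⟨z, h1, by rw [mul_comm, h1]⟩
  have h := eval₂_reflect_mul_pow (RingHom.id ℂ) (conj z) n ((monicOP ν n).map (starRingEnd ℂ))
    (by rw [natDegree_map, natDegree_monicOP])
  have h2 : (⅟(conj z) : ℂ) = z := rfl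
  rw [h2] at h
  simp only [eval₂_id, eval_map] at h
  rw [eval₂_at_apply] at h
  rw [← h, reciprocalOP, mul_comm, mul_assoc, ← mul_pow, mul_comm (conj z), h1, one_pow, mul_one]

lemma eval_one_reciprocalOP (ν : Measure ℂ) (n : ℕ) :
    (reciprocalOP ν n).eval 1 = conj ((monicOP ν n).eval 1) := by
  rw [eval_reciprocalOP_of_norm_eq_one ν n norm_one, one_pow, one_mul]

lemma conj_verblunsky (ν : Measure ℂ) (n : ℕ) :
    conj (verblunsky ν n) = -(monicOP ν (n + 1)).eval 0 := by
  simp [verblunsky]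

section Orthogonality

variable {ν : Measure ℂ} [IsFiniteMeasure ν] (hc : ∀ᵐ z ∂ν, ‖z‖ = 1) (hs : ν.support.Infinite)
include hc hs

lemma polyInner_monicOP_of_lt {n k : ℕ} (hk : k < n) :
    polyInner ν (monicOP ν n) (monicOP ν k) = 0 := by
  induction n using Nat.strong_induction_on generalizing k with
  | _ n ih =>
    rw [monicOP_eq ν n, polyInner_sub_left hc, polyInner_sum_left hc,
      Finset.sum_eq_single (⟨k, hk⟩ : Fin n)]
    · rw [polyInner_C_mul_left,
        div_mul_cancel₀ _ (polyInner_self_ne_zero hc hs (monicOP_ne_zero ν k)), sub_self]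
    · intro j _ hj
      rw [polyInner_C_mul_left]
      rcases lt_or_gt_of_ne (fun h => hj (Fin.ext h) : (j : ℕ) ≠ k) with h | h
      · rw [← conj_polyInner (monicOP ν k), ih k hk h, map_zero, mul_zero]
      · rw [ih j j.2 h, mul_zero]
    · simp

lemma polyInner_monicOP_X_pow_of_lt {n k : ℕ} (hk : k < n) :
    polyInner ν (monicOP ν n) (X ^ k) = 0 := by
  have h : (X ^ k : ℂ[X]) = monicOP ν k - ∑ j : Fin k, C (-(polyInner ν (X ^ k) (monicOP ν j) /
      polyInner ν (monicOP ν j) (monicOP ν j))) * monicOP ν j := by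
    conv_rhs => rw [monicOP_eq ν k]
    simp
  rw [h, polyInner_sub_right hc, polyInner_sum_right hc, polyInner_monicOP_of_lt hc hs hk,
    Finset.sum_eq_zero, sub_zero]
  intro j _
  rw [polyInner_C_mul_right, polyInner_monicOP_of_lt hc hs (j.2.trans hk), mul_zero]

lemma polyInner_monicOP_of_natDegree_lt {n : ℕ} {p : ℂ[X]} (hp : p.natDegree < n) :
    polyInner ν (monicOP ν n) p = 0 := by
  rw [polyInner_eq_sum_coeff_right hc _ hp]
  exact Finset.sum_eq_zero fun i hi => by
    rw [polyInner_monicOP_X_pow_of_lt hc hs (Finset.mem_range.1 hi), mul_zero]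

lemma polyInner_monicOP_of_monic {n : ℕ} {p : ℂ[X]} (hp : p.Monic) (hn : p.natDegree = n) :
    polyInner ν (monicOP ν n) p = polyInner ν (monicOP ν n) (monicOP ν n) := by
  rw [polyInner_eq_sum_coeff_right hc _ (Nat.lt_succ_of_le hn.le),
    polyInner_eq_sum_coeff_right hc _ (Nat.lt_succ_of_le (natDegree_monicOP ν n).le),
    Finset.sum_range_succ, Finset.sum_range_succ, coeff_monicOP_self]
  rw [Monic, leadingCoeff, hn] at hp
  rw [hp]
  congr 1
  refine Finset.sum_congr rfl fun i hi => ?_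
  rw [polyInner_monicOP_X_pow_of_lt hc hs (Finset.mem_range.1 hi), mul_zero, mul_zero]

omit [IsFiniteMeasure ν] hs in
lemma polyInner_reciprocalOP_X_pow {n k : ℕ} (hk : k ≤ n) :
    polyInner ν (reciprocalOP ν n) (X ^ k) = conj (polyInner ν (monicOP ν n) (X ^ (n - k))) := by
  rw [conj_polyInner]
  unfold polyInner
  refine integral_congr_ae ?_
  filter_upwards [hc] with z hz
  have h1 : z * conj z = 1 := mul_conj_eq_one hz
  rw [eval_reciprocalOP_of_norm_eq_one ν n hz]
  simp only [eval_pow, eval_X, map_pow]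
  have h2 : z ^ n * conj z ^ k = z ^ (n - k) := by
    conv_lhs => rw [← Nat.sub_add_cancel hk, pow_add, mul_assoc, ← mul_pow, h1, one_pow, mul_one]
  linear_combination (conj ((monicOP ν n).eval z)) * h2

/-- `Φ_n^*` is orthogonal to `z, ..., z ^ n`. -/
lemma polyInner_reciprocalOP_X_pow_of_pos {n k : ℕ} (hk : k ≤ n) (h0 : 0 < k) :
    polyInner ν (reciprocalOP ν n) (X ^ k) = 0 := by
  rw [polyInner_reciprocalOP_X_pow hc hk, polyInner_monicOP_X_pow_of_lt hc hs (by omega), map_zero]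

lemma polyInner_reciprocalOP_one (n : ℕ) :
    polyInner ν (reciprocalOP ν n) 1 = polyInner ν (monicOP ν n) (monicOP ν n) := by
  have h := polyInner_reciprocalOP_X_pow hc (ν := ν) (Nat.zero_le n)
  rw [pow_zero, Nat.sub_zero,
    polyInner_monicOP_of_monic hc hs (monic_X_pow n) (natDegree_X_pow n), conj_polyInner] at h
  exact h

/-- The Szegő recurrence. Both sides have the same value at `0`, so their difference is `X * F`
with `F` of degree `< n`, and orthogonality to `z, ..., z ^ n` makes `F` orthogonal to
`1, ..., z ^ (n - 1)`. -/
lemma monicOP_succ (n : ℕ) :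
    monicOP ν (n + 1) = X * monicOP ν n - C (conj (verblunsky ν n)) * reciprocalOP ν n := by
  set E := monicOP ν (n + 1) - (X * monicOP ν n - C (conj (verblunsky ν n)) * reciprocalOP ν n)
    with hE
  have hE0 : eval 0 E = 0 := by
    simp [hE, conj_verblunsky, eval_zero_reciprocalOP]
  obtain ⟨F, hF⟩ : X ∣ E := by
    rw [X_dvd_iff, coeff_zero_eq_eval_zero, hE0]
  have hXdeg : (X * monicOP ν n).degree = ((n + 1 : ℕ) : WithBot ℕ) := by
    rw [degree_mul, degree_X, degree_monicOP, add_comm]; norm_cast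
  have hEdeg : E.degree < ((n + 1 : ℕ) : WithBot ℕ) := by
    rw [hE, ← sub_add]
    refine (degree_add_le _ _).trans_lt (max_lt ?_ ?_)
    · rw [← degree_monicOP ν (n + 1)]
      refine degree_sub_lt_left ?_ (monicOP_ne_zero _ _) ?_
      · rw [hXdeg, degree_monicOP]
      · rw [(monic_monicOP ν (n + 1)).leadingCoeff,
          (monic_X.mul (monic_monicOP ν n)).leadingCoeff]
    · refine degree_C_mul_lt ?_ _
      refine degree_le_natDegree.trans_lt ?_
      exact_mod_cast Nat.lt_succ_of_le (natDegree_reciprocalOP_le ν n)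
  have hF0 : F = 0 := by
    refine eq_zero_of_polyInner_X_pow_eq_zero hc hs (n := n) ?_ ?_
    · by_cases h0 : F = 0
      · rw [h0, degree_zero]; exact WithBot.bot_lt_coe n
      · rw [hF, degree_mul, degree_X, degree_eq_natDegree h0] at hEdeg
        rw [degree_eq_natDegree h0]
        norm_cast at hEdeg ⊢
        omega
    · intro k hk
      rw [← polyInner_X_mul_X_mul hc, ← hF, ← pow_succ', hE, polyInner_sub_left hc,
        polyInner_sub_left hc, polyInner_C_mul_left,
        polyInner_monicOP_X_pow_of_lt hc hs (by omega),
        polyInner_reciprocalOP_X_pow_of_pos hc hs (by omega) (by omega), pow_succ',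
        polyInner_X_mul_X_mul hc, polyInner_monicOP_X_pow_of_lt hc hs hk]
      simp
  rw [hF0, mul_zero] at hF
  exact sub_eq_zero.1 hF

lemma reciprocalOP_succ (n : ℕ) :
    reciprocalOP ν (n + 1) = reciprocalOP ν n - C (verblunsky ν n) * (X * monicOP ν n) := by
  have h1 : reflect (n + 1) (X * (monicOP ν n).map (starRingEnd ℂ)) = reciprocalOP ν n := by
    rw [add_comm, reflect_mul X _ natDegree_X_le
      (by rw [natDegree_map, natDegree_monicOP] : _ ≤ n), reflect_one_X, one_mul, reciprocalOP]
  have h2 : reflect (n + 1) ((reciprocalOP ν n).map (starRingEnd ℂ)) = X * monicOP ν n := by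
    have h3 : (reciprocalOP ν n).map (starRingEnd ℂ) = reflect n (monicOP ν n) := by
      rw [reciprocalOP, reflect_map, Polynomial.map_map]
      convert Polynomial.map_id
      ext; simp
    have h4 := reflect_mul (1 : ℂ[X]) (reflect n (monicOP ν n)) (F := 1) (G := n) (by simp)
      (natDegree_reflect_le.trans (by rw [natDegree_monicOP, max_self]))
    rw [one_mul, reflect_one, pow_one, reflect_reflect] at h4
    rw [h3, add_comm, h4]
  conv_lhs => rw [reciprocalOP, monicOP_succ hc hs]
  rw [Polynomial.map_sub, Polynomial.map_mul, Polynomial.map_mul, reflect_sub, map_X, h1, map_C,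
    reflect_C_mul, h2, Complex.conj_conj]

/-- The squared norms of the monic orthogonal polynomials satisfy
`‖Φ_{n+1}‖² = (1 - |a_n|²) ‖Φ_n‖²`. -/
lemma integral_norm_sq_monicOP_succ (n : ℕ) :
    ∫ z, ‖(monicOP ν (n + 1)).eval z‖ ^ 2 ∂ν =
      (1 - ‖verblunsky ν n‖ ^ 2) * ∫ z, ‖(monicOP ν n).eval z‖ ^ 2 ∂ν := by
  have key : polyInner ν (monicOP ν (n + 1)) (monicOP ν (n + 1)) =
      (1 - ‖verblunsky ν n‖ ^ 2) * polyInner ν (monicOP ν n) (monicOP ν n) := by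
    -- the second argument may be replaced by any monic polynomial of degree `n + 1`
    have h1 : polyInner ν (monicOP ν (n + 1)) (monicOP ν (n + 1)) =
        polyInner ν (monicOP ν (n + 1)) (X * monicOP ν n) := by
      rw [polyInner_monicOP_of_monic hc hs (monic_X.mul (monic_monicOP ν n))]
      rw [natDegree_X_mul (monicOP_ne_zero _ _), natDegree_monicOP]
    have h3 : X * monicOP ν n = monicOP ν (n + 1) - C (-conj (verblunsky ν n)) *
        reciprocalOP ν n := by
      rw [monicOP_succ hc hs]; simp
    have h4 : polyInner ν (reciprocalOP ν n) (reciprocalOP ν n) =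
        polyInner ν (monicOP ν n) (monicOP ν n) := by
      unfold polyInner
      refine integral_congr_ae ?_
      filter_upwards [hc] with z hz
      have h1 : z * conj z = 1 := mul_conj_eq_one hz
      simp only [eval_reciprocalOP_of_norm_eq_one ν n hz, map_mul, map_pow, Complex.conj_conj]
      have h5 : z ^ n * conj z ^ n = 1 := by rw [← mul_pow, h1, one_pow]
      linear_combination (conj ((monicOP ν n).eval z)) * ((monicOP ν n).eval z) * h5
    have h5 : polyInner ν (reciprocalOP ν n) (X * monicOP ν n) =
        verblunsky ν n * polyInner ν (monicOP ν n) (monicOP ν n) := by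
      rw [h3, polyInner_sub_right hc, polyInner_C_mul_right, h4, ← conj_polyInner,
        polyInner_monicOP_of_natDegree_lt hc hs
          (Nat.lt_succ_of_le (natDegree_reciprocalOP_le ν n))]
      simp
    rw [h1]
    conv_lhs => rw [monicOP_succ hc hs]
    rw [polyInner_sub_left hc, polyInner_C_mul_left, h5, polyInner_X_mul_X_mul hc]
    have h6 := Complex.mul_conj (verblunsky ν n)
    rw [Complex.normSq_eq_norm_sq] at h6
    push_cast at h6
    linear_combination (-polyInner ν (monicOP ν n) (monicOP ν n)) * h6
  rw [polyInner_self, polyInner_self] at key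
  exact_mod_cast key

/-- By `‖Φ_{n+1}‖² = (1 - |a_n|²) ‖Φ_n‖²`, in which both norms are positive. -/
lemma norm_verblunsky_lt_one (n : ℕ) : ‖verblunsky ν n‖ < 1 := by
  have h := integral_norm_sq_eval_pos hc hs (monicOP_ne_zero ν (n + 1))
  rw [integral_norm_sq_monicOP_succ hc hs] at h
  have h1 := (mul_pos_iff_of_pos_right
    (integral_norm_sq_eval_pos hc hs (monicOP_ne_zero ν n))).1 h
  have h2 := norm_nonneg (verblunsky ν n)
  nlinarith

lemma eval_one_monicOP_succ (n : ℕ) :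
    (monicOP ν (n + 1)).eval 1 = (monicOP ν n).eval 1 -
      conj (verblunsky ν n) * conj ((monicOP ν n).eval 1) := by
  rw [monicOP_succ hc hs]
  simp [eval_one_reciprocalOP]

lemma eval_one_monicOP_ne_zero (n : ℕ) : (monicOP ν n).eval 1 ≠ 0 := by
  induction n with
  | zero => simp
  | succ n ih =>
    rw [eval_one_monicOP_succ hc hs]
    intro h
    have h1 := congrArg norm (sub_eq_zero.1 h)
    rw [norm_mul, RCLike.norm_conj, RCLike.norm_conj] at h1
    have h2 := norm_pos_iff.2 ih
    have h3 := norm_verblunsky_lt_one hc hs n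
    nlinarith

end Orthogonality

/-! ### The rotated Verblunsky coefficients and the parameters `g_n`, `c_n`, `d_n` -/

/-- The rotated Verblunsky coefficients `b_n = ρ_n a_n`. They have the same modulus as `a_n`, and
all the parameters `g_n`, `c_n`, `d_n` are functions of them. -/
noncomputable def rotVerblunsky (ν : Measure ℂ) (n : ℕ) : ℂ := rho ν n * verblunsky ν n

lemma rho_eq (ν : Measure ℂ) (n : ℕ) :
    rho ν n = (monicOP ν n).eval 1 / conj ((monicOP ν n).eval 1) := by
  rw [rho, eval_one_reciprocalOP]

lemma gParam_succ (ν : Measure ℂ) (n : ℕ) : gParam ν (n + 1) =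
    1 / 2 * (‖1 - rotVerblunsky ν n‖ ^ 2 / (1 - (rotVerblunsky ν n).re)) := rfl

lemma cCoeff_succ (ν : Measure ℂ) (n : ℕ) : cCoeff ν (n + 1) =
    (rotVerblunsky ν n).im / ((rotVerblunsky ν n).re - 1) := rfl

lemma norm_sq_one_sub (b : ℂ) : ‖1 - b‖ ^ 2 = 1 - 2 * b.re + ‖b‖ ^ 2 := by
  rw [← Complex.normSq_eq_norm_sq, ← Complex.normSq_eq_norm_sq, Complex.normSq_apply,
    Complex.normSq_apply]
  simp
  ring

section Parameters

variable {ν : Measure ℂ} [IsFiniteMeasure ν] (hc : ∀ᵐ z ∂ν, ‖z‖ = 1) (hs : ν.support.Infinite)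
include hc hs

lemma conj_eval_one_monicOP_ne_zero (n : ℕ) : conj ((monicOP ν n).eval 1) ≠ 0 :=
  (_root_.map_ne_zero _).2 (eval_one_monicOP_ne_zero hc hs n)

lemma norm_rho (n : ℕ) : ‖rho ν n‖ = 1 := by
  rw [rho_eq, norm_div, RCLike.norm_conj,
    div_self (norm_ne_zero_iff.2 (eval_one_monicOP_ne_zero hc hs n))]

lemma norm_rotVerblunsky (n : ℕ) : ‖rotVerblunsky ν n‖ = ‖verblunsky ν n‖ := by
  rw [rotVerblunsky, norm_mul, norm_rho hc hs, one_mul]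

lemma norm_rotVerblunsky_lt_one (n : ℕ) : ‖rotVerblunsky ν n‖ < 1 :=
  (norm_rotVerblunsky hc hs n).trans_lt (norm_verblunsky_lt_one hc hs n)

lemma one_sub_re_rotVerblunsky_pos (n : ℕ) : 0 < 1 - (rotVerblunsky ν n).re :=
  sub_pos.2 ((Complex.re_le_norm _).trans_lt (norm_rotVerblunsky_lt_one hc hs n))

lemma rotVerblunsky_mul_conj_eval_one (n : ℕ) :
    rotVerblunsky ν n * conj ((monicOP ν n).eval 1) =
      verblunsky ν n * (monicOP ν n).eval 1 := by
  have h := conj_eval_one_monicOP_ne_zero hc hs n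
  rw [rotVerblunsky, rho_eq]
  field_simp

lemma conj_rotVerblunsky_mul_eval_one (n : ℕ) :
    conj (rotVerblunsky ν n) * (monicOP ν n).eval 1 =
      conj (verblunsky ν n) * conj ((monicOP ν n).eval 1) := by
  have h := congrArg conj (rotVerblunsky_mul_conj_eval_one hc hs n)
  simpa using h

lemma eval_one_monicOP_succ_eq_mul (n : ℕ) :
    (monicOP ν (n + 1)).eval 1 = (1 - conj (rotVerblunsky ν n)) * (monicOP ν n).eval 1 := by
  rw [eval_one_monicOP_succ hc hs, sub_mul, conj_rotVerblunsky_mul_eval_one hc hs, one_mul]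

lemma one_sub_gParam_succ (n : ℕ) : 1 - gParam ν (n + 1) =
    (1 - ‖rotVerblunsky ν n‖ ^ 2) / (2 * (1 - (rotVerblunsky ν n).re)) := by
  have h := (one_sub_re_rotVerblunsky_pos hc hs n).ne'
  rw [gParam_succ, norm_sq_one_sub]
  field_simp
  ring

lemma one_add_I_mul_cCoeff_succ (n : ℕ) :
    (1 + Complex.I * (cCoeff ν (n + 1) : ℂ)) * ((1 - (rotVerblunsky ν n).re : ℝ) : ℂ) =
      1 - rotVerblunsky ν n := by
  have h := one_sub_re_rotVerblunsky_pos hc hs n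
  have h' : cCoeff ν (n + 1) * (1 - (rotVerblunsky ν n).re) = -(rotVerblunsky ν n).im := by
    have : (rotVerblunsky ν n).re - 1 ≠ 0 := by linarith
    rw [cCoeff_succ, div_mul_eq_mul_div, div_eq_iff this]
    ring
  apply Complex.ext
  · simp
  · simp [h']

lemma one_sub_I_mul_cCoeff_succ (n : ℕ) :
    (1 - Complex.I * (cCoeff ν (n + 1) : ℂ)) * ((1 - (rotVerblunsky ν n).re : ℝ) : ℂ) =
      1 - conj (rotVerblunsky ν n) := by
  have h := congrArg conj (one_add_I_mul_cCoeff_succ hc hs n)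
  simpa [← sub_eq_add_neg] using h

lemma four_mul_dCoeff_add_two (n : ℕ) :
    4 * (dCoeff ν (n + 2) : ℂ) * ((1 - (rotVerblunsky ν n).re : ℝ) : ℂ) *
      ((1 - (rotVerblunsky ν (n + 1)).re : ℝ) : ℂ) =
    (1 - rotVerblunsky ν n * conj (rotVerblunsky ν n)) * ((1 - rotVerblunsky ν (n + 1)) *
      (1 - conj (rotVerblunsky ν (n + 1)))) := by
  have h1 := (one_sub_re_rotVerblunsky_pos hc hs n).ne'
  have h2 := (one_sub_re_rotVerblunsky_pos hc hs (n + 1)).ne'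
  have h3 : (1 - rotVerblunsky ν (n + 1)) * (1 - conj (rotVerblunsky ν (n + 1))) =
      ((‖1 - rotVerblunsky ν (n + 1)‖ ^ 2 : ℝ) : ℂ) := by
    rw [← Complex.normSq_eq_norm_sq, ← Complex.mul_conj]
    simp
  have h4 : (1 - rotVerblunsky ν n * conj (rotVerblunsky ν n)) =
      ((1 - ‖rotVerblunsky ν n‖ ^ 2 : ℝ) : ℂ) := by
    rw [Complex.mul_conj, Complex.normSq_eq_norm_sq]
    push_cast
    ring
  rw [h3, h4]
  norm_cast
  have h5 : dCoeff ν (n + 2) = (1 - gParam ν (n + 1)) * gParam ν (n + 1 + 1) := rfl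
  rw [h5, one_sub_gParam_succ hc hs, gParam_succ]
  field_simp
  ring

end Parameters

/-! ### The Christoffel-Darboux kernel -/

lemma orthonormalOP_term (ν : Measure ℂ) (n : ℕ) (w : ℂ) :
    C (conj ((orthonormalOP ν n).eval w)) * orthonormalOP ν n =
      C (conj ((monicOP ν n).eval w) / ((∫ z, ‖(monicOP ν n).eval z‖ ^ 2 ∂ν : ℝ) : ℂ)) *
        monicOP ν n := by
  have h0 : 0 ≤ ∫ z, ‖(monicOP ν n).eval z‖ ^ 2 ∂ν := integral_nonneg fun z => by positivity
  have h1 : (((Real.sqrt (∫ z, ‖(monicOP ν n).eval z‖ ^ 2 ∂ν))⁻¹ : ℝ) : ℂ) *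
      (((Real.sqrt (∫ z, ‖(monicOP ν n).eval z‖ ^ 2 ∂ν))⁻¹ : ℝ) : ℂ) =
      ((∫ z, ‖(monicOP ν n).eval z‖ ^ 2 ∂ν : ℝ) : ℂ)⁻¹ := by
    rw [← Complex.ofReal_mul, ← mul_inv, Real.mul_self_sqrt h0, Complex.ofReal_inv]
  rw [orthonormalOP, ← mul_assoc, ← C_mul]
  congr 2
  simp only [eval_mul, eval_C, map_mul, Complex.conj_ofReal]
  rw [div_eq_mul_inv, ← h1]
  ring

lemma cdKernel_eq (ν : Measure ℂ) (n : ℕ) (w : ℂ) :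
    cdKernel ν n w = ∑ j ∈ Finset.range (n + 1),
      C (conj ((monicOP ν j).eval w) / ((∫ z, ‖(monicOP ν j).eval z‖ ^ 2 ∂ν : ℝ) : ℂ)) *
        monicOP ν j :=
  Finset.sum_congr rfl fun j _ => orthonormalOP_term ν j w

lemma natDegree_cdKernel_le (ν : Measure ℂ) (n : ℕ) (w : ℂ) : (cdKernel ν n w).natDegree ≤ n := by
  rw [cdKernel_eq]
  refine natDegree_sum_le_of_forall_le _ _ fun j hj => (natDegree_C_mul_le _ _).trans ?_
  rw [natDegree_monicOP]
  exact Nat.lt_succ_iff.1 (Finset.mem_range.1 hj)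

lemma coeff_cdKernel_self (ν : Measure ℂ) (n : ℕ) (w : ℂ) : (cdKernel ν n w).coeff n =
    conj ((monicOP ν n).eval w) / ((∫ z, ‖(monicOP ν n).eval z‖ ^ 2 ∂ν : ℝ) : ℂ) := by
  rw [cdKernel_eq, finsetSum_coeff, Finset.sum_range_succ, Finset.sum_eq_zero, zero_add,
    coeff_C_mul, coeff_monicOP_self, mul_one]
  intro j hj
  rw [coeff_C_mul, coeff_eq_zero_of_natDegree_lt, mul_zero]
  rw [natDegree_monicOP]
  exact Finset.mem_range.1 hj

/-- The numerator `s_n = Φ_n(1) Φ_n^* - conj (Φ_n(1)) z Φ_n` in the Christoffel-Darboux formula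
for the kernel at `w = 1`. -/
noncomputable def cdNumerator (ν : Measure ℂ) (n : ℕ) : ℂ[X] :=
  C ((monicOP ν n).eval 1) * reciprocalOP ν n -
    X * (C (conj ((monicOP ν n).eval 1)) * monicOP ν n)

lemma prod_one_add_I_mul_cCoeff_ne_zero (ν : Measure ℂ) (n : ℕ) :
    ∏ k ∈ Finset.Icc 1 n, (1 + Complex.I * (cCoeff ν k : ℂ)) ≠ 0 := by
  refine Finset.prod_ne_zero_iff.2 fun k _ h => ?_
  simpa using congrArg Complex.re h

lemma natDegree_normalizedKernel_le (ν : Measure ℂ) (n : ℕ) : (normalizedKernel ν n).natDegree ≤ n :=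
  (natDegree_C_mul_le _ _).trans (natDegree_cdKernel_le ν n 1)

section Kernel

variable {ν : Measure ℂ} [IsFiniteMeasure ν] (hc : ∀ᵐ z ∂ν, ‖z‖ = 1) (hs : ν.support.Infinite)
include hc hs

/-- The reproducing property of the kernel, on monomials. -/
lemma polyInner_cdKernel_X_pow {n k : ℕ} (hk : k ≤ n) (w : ℂ) :
    polyInner ν (cdKernel ν n w) (X ^ k) = conj (w ^ k) := by
  have h1 : ∀ j ≤ n, polyInner ν (cdKernel ν n w) (monicOP ν j) =
      conj ((monicOP ν j).eval w) := by
    intro j hj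
    rw [cdKernel_eq, polyInner_sum_left hc, Finset.sum_eq_single j]
    · rw [polyInner_C_mul_left, ← polyInner_self,
        div_mul_cancel₀ _ (polyInner_self_ne_zero hc hs (monicOP_ne_zero ν j))]
    · intro i _ hi
      rw [polyInner_C_mul_left]
      rcases lt_or_gt_of_ne hi with h | h
      · rw [← conj_polyInner, polyInner_monicOP_of_lt hc hs h, map_zero, mul_zero]
      · rw [polyInner_monicOP_of_lt hc hs h, mul_zero]
    · intro h
      exact absurd (Finset.mem_range.2 (Nat.lt_succ_of_le hj)) h
  have h2 : (X ^ k : ℂ[X]) = monicOP ν k - ∑ j : Fin k, C (-(polyInner ν (X ^ k) (monicOP ν j) /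
      polyInner ν (monicOP ν j) (monicOP ν j))) * monicOP ν j := by
    conv_rhs => rw [monicOP_eq ν k]
    simp
  have h3 : (w ^ k : ℂ) = (X ^ k : ℂ[X]).eval w := by simp
  rw [h3, h2, polyInner_sub_right hc, polyInner_sum_right hc, h1 k hk, eval_sub, map_sub,
    eval_finsetSum, map_sum]
  congr 1
  refine Finset.sum_congr rfl fun j _ => ?_
  rw [polyInner_C_mul_right, h1 j (j.2.le.trans hk), eval_mul, eval_C, map_mul]

lemma C_eval_one_mul_reciprocalOP_succ (n : ℕ) :
    C ((monicOP ν (n + 1)).eval 1) * reciprocalOP ν (n + 1) =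
      C (1 - conj (rotVerblunsky ν n)) * (C ((monicOP ν n).eval 1) * reciprocalOP ν n -
        C (rotVerblunsky ν n) * (X * (C (conj ((monicOP ν n).eval 1)) * monicOP ν n))) := by
  have h := congrArg C (rotVerblunsky_mul_conj_eval_one hc hs n)
  rw [C_mul, C_mul] at h
  rw [reciprocalOP_succ hc hs, eval_one_monicOP_succ_eq_mul hc hs, C_mul]
  linear_combination (C (1 - conj (rotVerblunsky ν n)) * X * monicOP ν n) * h

lemma C_conj_eval_one_mul_monicOP_succ (n : ℕ) :
    C (conj ((monicOP ν (n + 1)).eval 1)) * monicOP ν (n + 1) =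
      C (1 - rotVerblunsky ν n) * (X * (C (conj ((monicOP ν n).eval 1)) * monicOP ν n) -
        C (conj (rotVerblunsky ν n)) * (C ((monicOP ν n).eval 1) * reciprocalOP ν n)) := by
  have h := congrArg C (conj_rotVerblunsky_mul_eval_one hc hs n)
  rw [C_mul, C_mul] at h
  rw [eval_one_monicOP_succ_eq_mul hc hs, monicOP_succ hc hs, map_mul, map_sub, map_one,
    Complex.conj_conj, C_mul]
  linear_combination (C (1 - rotVerblunsky ν n) * reciprocalOP ν n) * h

/-- The numerator of the other form of the Christoffel-Darboux formula, which expresses `K_n`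
through `Φ_{n+1}` and `Φ_{n+1}^*`. -/
lemma cdNumerator_eq_of_succ (n : ℕ) :
    C ((monicOP ν (n + 1)).eval 1) * reciprocalOP ν (n + 1) -
      C (conj ((monicOP ν (n + 1)).eval 1)) * monicOP ν (n + 1) =
    C (1 - rotVerblunsky ν n * conj (rotVerblunsky ν n)) * cdNumerator ν n := by
  rw [C_eval_one_mul_reciprocalOP_succ hc hs, C_conj_eval_one_mul_monicOP_succ hc hs, cdNumerator]
  simp only [C_sub, C_mul, C_1]
  ring

/-- The three term recurrence for the numerators of the Christoffel-Darboux formula. -/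
lemma cdNumerator_add_two (n : ℕ) :
    cdNumerator ν (n + 2) =
      (C (1 - rotVerblunsky ν (n + 1)) * X + C (1 - conj (rotVerblunsky ν (n + 1)))) *
        cdNumerator ν (n + 1) -
      C ((1 - rotVerblunsky ν n * conj (rotVerblunsky ν n)) * ((1 - rotVerblunsky ν (n + 1)) *
        (1 - conj (rotVerblunsky ν (n + 1))))) * X * cdNumerator ν n := by
  rw [C_mul]
  have h := cdNumerator_eq_of_succ hc hs n
  rw [show cdNumerator ν (n + 2) = C ((monicOP ν (n + 2)).eval 1) * reciprocalOP ν (n + 2) -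
    X * (C (conj ((monicOP ν (n + 2)).eval 1)) * monicOP ν (n + 2)) from rfl,
    C_eval_one_mul_reciprocalOP_succ hc hs (n + 1),
    C_conj_eval_one_mul_monicOP_succ hc hs (n + 1),
    show cdNumerator ν (n + 1) = C ((monicOP ν (n + 1)).eval 1) * reciprocalOP ν (n + 1) -
    X * (C (conj ((monicOP ν (n + 1)).eval 1)) * monicOP ν (n + 1)) from rfl]
  simp only [C_sub, C_mul, C_1] at h ⊢
  linear_combination (-(1 - C (rotVerblunsky ν (n + 1))) *
    (1 - C (conj (rotVerblunsky ν (n + 1)))) * X) * h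

/-- The Christoffel-Darboux formula at `w = 1`. -/
lemma one_sub_X_mul_cdKernel (n : ℕ) :
    (1 - X) * (C ((∫ z, ‖(monicOP ν n).eval z‖ ^ 2 ∂ν : ℝ) : ℂ) * cdKernel ν n 1) =
      cdNumerator ν n := by
  have hN : ∀ n, ((∫ z, ‖(monicOP ν n).eval z‖ ^ 2 ∂ν : ℝ) : ℂ) ≠ 0 := fun n => by
    exact_mod_cast (integral_norm_sq_eval_pos hc hs (monicOP_ne_zero ν n)).ne'
  induction n with
  | zero =>
    have h := hN 0
    rw [cdKernel_eq, zero_add, Finset.sum_range_one, ← mul_assoc (C _) (C _), ← C_mul,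
      mul_div_cancel₀ _ h, cdNumerator]
    simp
  | succ n ih =>
    have h := cdNumerator_eq_of_succ hc hs n
    have h1 : ((∫ z, ‖(monicOP ν (n + 1)).eval z‖ ^ 2 ∂ν : ℝ) : ℂ) =
        (1 - rotVerblunsky ν n * conj (rotVerblunsky ν n)) *
          ((∫ z, ‖(monicOP ν n).eval z‖ ^ 2 ∂ν : ℝ) : ℂ) := by
      rw [integral_norm_sq_monicOP_succ hc hs, ← norm_rotVerblunsky hc hs, Complex.mul_conj,
        Complex.normSq_eq_norm_sq]
      push_cast
      ring
    have h2 : cdKernel ν (n + 1) 1 = cdKernel ν n 1 +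
        C (conj ((monicOP ν (n + 1)).eval 1) /
          ((∫ z, ‖(monicOP ν (n + 1)).eval z‖ ^ 2 ∂ν : ℝ) : ℂ)) * monicOP ν (n + 1) := by
      rw [cdKernel_eq, Finset.sum_range_succ, ← cdKernel_eq]
    rw [h2, mul_add (C _), ← mul_assoc (C _) (C _), ← C_mul, mul_div_cancel₀ _ (hN (n + 1)), h1,
      C_mul, cdNumerator]
    rw [← ih] at h
    linear_combination -h

/-- The normalization `2 ^ n ξ_n` in terms of the norm of `Φ_n`: each factor is
`2 (1 - g_{j+1}) = (1 - |b_j|²) / (1 - Re b_j)`. -/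
lemma two_pow_mul_xi (n : ℕ) :
    2 ^ n * xi ν n * ∏ j ∈ Finset.range n, (1 - (rotVerblunsky ν j).re) =
      ∫ z, ‖(monicOP ν n).eval z‖ ^ 2 ∂ν := by
  induction n with
  | zero => simp [xi, Measure.real]
  | succ n ih =>
    have h : xi ν (n + 1) = xi ν n * (1 - gParam ν (n + 1)) := by
      rw [xi, xi, Finset.prod_Icc_succ_top (by omega), mul_assoc]
    have h1 := (one_sub_re_rotVerblunsky_pos hc hs n).ne'
    rw [integral_norm_sq_monicOP_succ hc hs, ← norm_rotVerblunsky hc hs, ← ih, h,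
      Finset.prod_range_succ, one_sub_gParam_succ hc hs]
    field_simp
    ring

lemma prod_one_sub_re_rotVerblunsky_ne_zero (n : ℕ) :
    ((∏ j ∈ Finset.range n, (1 - (rotVerblunsky ν j).re) : ℝ) : ℂ) ≠ 0 := by
  exact_mod_cast (Finset.prod_pos fun j _ => one_sub_re_rotVerblunsky_pos hc hs j).ne'

lemma one_sub_X_mul_normalizedKernel (n : ℕ) :
    (1 - X) * (C ((∏ j ∈ Finset.range n, (1 - (rotVerblunsky ν j).re) : ℝ) : ℂ) *
      normalizedKernel ν n) = cdNumerator ν n := by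
  rw [← one_sub_X_mul_cdKernel hc hs, normalizedKernel, ← two_pow_mul_xi hc hs, ← mul_assoc (C _),
    ← C_mul]
  congr 3
  push_cast
  ring

/-- The leading coefficient is `conj (Φ_n(1)) / ∏ (1 - Re b_j) = ∏ (1 - b_j) / (1 - Re b_j)`. -/
lemma coeff_normalizedKernel_self (n : ℕ) : (normalizedKernel ν n).coeff n =
    ∏ k ∈ Finset.Icc 1 n, (1 + Complex.I * (cCoeff ν k : ℂ)) := by
  have h1 := prod_one_sub_re_rotVerblunsky_ne_zero hc hs n
  have h2 : ((2 ^ n * xi ν n : ℝ) : ℂ) *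
      ((∏ j ∈ Finset.range n, (1 - (rotVerblunsky ν j).re) : ℝ) : ℂ) =
      ((∫ z, ‖(monicOP ν n).eval z‖ ^ 2 ∂ν : ℝ) : ℂ) := by
    rw [← two_pow_mul_xi hc hs]
    push_cast
    ring
  have hN : ((∫ z, ‖(monicOP ν n).eval z‖ ^ 2 ∂ν : ℝ) : ℂ) ≠ 0 := by
    exact_mod_cast (integral_norm_sq_eval_pos hc hs (monicOP_ne_zero ν n)).ne'
  have h3 : conj ((monicOP ν n).eval 1) =
      (∏ k ∈ Finset.Icc 1 n, (1 + Complex.I * (cCoeff ν k : ℂ))) *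
      ((∏ j ∈ Finset.range n, (1 - (rotVerblunsky ν j).re) : ℝ) : ℂ) := by
    clear h1 h2 hN
    induction n with
    | zero => simp
    | succ n ih =>
      rw [eval_one_monicOP_succ_eq_mul hc hs, map_mul, ih, Finset.prod_Icc_succ_top (by omega),
        Finset.prod_range_succ, Complex.ofReal_mul, map_sub, map_one, Complex.conj_conj,
        ← one_add_I_mul_cCoeff_succ hc hs]
      ring
  rw [normalizedKernel, coeff_C_mul, coeff_cdKernel_self, h3, ← h2]
  rw [← h2] at hN
  have hN' := left_ne_zero_of_mul hN
  field_simp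

/-- The three term recurrence of the normalized kernels, which comes from the one of the
numerators `cdNumerator` upon division by `(1 - z) ∏ (1 - Re b_j)`. -/
lemma satisfiesRecurrence_normalizedKernel :
    SatisfiesRecurrence (normalizedKernel ν) (cCoeff ν) (dCoeff ν) := by
  have hX : (1 - X : ℂ[X]) ≠ 0 := by
    intro h
    simpa using congrArg (eval 0) h
  have hcancel : ∀ (n : ℕ) (p r : ℂ[X]),
      (1 - X) * (C ((∏ j ∈ Finset.range n, (1 - (rotVerblunsky ν j).re) : ℝ) : ℂ) * p) =
      (1 - X) * (C ((∏ j ∈ Finset.range n, (1 - (rotVerblunsky ν j).re) : ℝ) : ℂ) * r) →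
      p = r := fun n p r h => mul_left_cancel₀
    (C_ne_zero.2 (prod_one_sub_re_rotVerblunsky_ne_zero hc hs n)) (mul_left_cancel₀ hX h)
  have h0 : normalizedKernel ν 0 = 1 := by
    apply hcancel 0
    rw [one_sub_X_mul_normalizedKernel hc hs, cdNumerator]
    simp
  refine ⟨h0, ?_, ?_⟩
  · apply hcancel 1
    have h2 := congrArg C (one_add_I_mul_cCoeff_succ hc hs 0)
    have h3 := congrArg C (one_sub_I_mul_cCoeff_succ hc hs 0)
    have h4 : C (1 - rotVerblunsky ν 0) = 1 - C (rotVerblunsky ν 0) := by simp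
    have h5 : C (1 - conj (rotVerblunsky ν 0)) = 1 - C (conj (rotVerblunsky ν 0)) := by simp
    rw [C_mul] at h2 h3
    rw [one_sub_X_mul_normalizedKernel hc hs, cdNumerator, C_eval_one_mul_reciprocalOP_succ hc hs,
      C_conj_eval_one_mul_monicOP_succ hc hs, Finset.prod_range_one, reciprocalOP_zero,
      monicOP_zero, eval_one,
      map_one, map_one, C_1]
    linear_combination -(1 - X) * X * h2 - (1 - X) * h3 -
      (C (1 - conj (rotVerblunsky ν 0)) * X) * h4 + (X * C (1 - rotVerblunsky ν 0)) * h5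
  · intro m hm
    obtain ⟨n, rfl⟩ : ∃ n, m = n + 1 := ⟨m - 1, by omega⟩
    apply hcancel (n + 2)
    have e0 := one_sub_X_mul_normalizedKernel hc hs n
    have e1 := one_sub_X_mul_normalizedKernel hc hs (n + 1)
    have e2 := one_sub_X_mul_normalizedKernel hc hs (n + 2)
    rw [e2, cdNumerator_add_two hc hs, ← e0, ← e1, ← four_mul_dCoeff_add_two hc hs,
      ← one_add_I_mul_cCoeff_succ hc hs, ← one_sub_I_mul_cCoeff_succ hc hs,
      Nat.add_sub_cancel]
    simp only [Finset.prod_range_succ, C_mul, Complex.ofReal_mul]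
    ring

/-- The normalized kernels determine the coefficients of their recurrence: `c_{n+1}` is read off
from the leading coefficients, and then `d_{n+1}` because `R_{n-1} ≠ 0`. -/
lemma satisfiesRecurrence_normalizedKernel_unique {c d : ℕ → ℝ}
    (h : SatisfiesRecurrence (normalizedKernel ν) c d) :
    (∀ n, 1 ≤ n → c n = cCoeff ν n) ∧ ∀ n, 2 ≤ n → d n = dCoeff ν n := by
  obtain ⟨-, h1, h2⟩ := h
  obtain ⟨-, k1, k2⟩ := satisfiesRecurrence_normalizedKernel hc hs
  have hlead : ∀ n, (normalizedKernel ν n).coeff n ≠ 0 := fun n => by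
    rw [coeff_normalizedKernel_self hc hs]
    exact prod_one_add_I_mul_cCoeff_ne_zero ν n
  have hI : ∀ {x y : ℝ}, (1 + Complex.I * (x : ℂ)) = 1 + Complex.I * (y : ℂ) → x = y := by
    intro x y h
    simpa using congrArg Complex.im h
  have hcs : ∀ n, 1 ≤ n → c n = cCoeff ν n := by
    intro n hn
    obtain rfl | ⟨m, rfl⟩ : n = 1 ∨ ∃ m, n = m + 2 := by
      rcases n with _ | _ | m
      · omega
      · exact Or.inl rfl
      · exact Or.inr ⟨m, rfl⟩
    · rw [k1] at h1
      have := congrArg (fun p => coeff p 1) h1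
      simp only [coeff_add, coeff_C_mul, coeff_X_one, coeff_C_succ, mul_one, add_zero] at this
      exact (hI this).symm
    · have e := (h2 (m + 1) (by omega)).symm.trans (k2 (m + 1) (by omega))
      have e' := congrArg (fun p => coeff p (m + 1 + 1)) e
      have z1 : (normalizedKernel ν (m + 1)).coeff (m + 1 + 1) = 0 :=
        coeff_eq_zero_of_natDegree_lt
          (Nat.lt_succ_of_le (natDegree_normalizedKernel_le ν (m + 1)))
      have z2 : (normalizedKernel ν m).coeff (m + 1) = 0 :=
        coeff_eq_zero_of_natDegree_lt
          (Nat.lt_succ_of_le (natDegree_normalizedKernel_le ν m))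
      simp only [add_mul, mul_assoc, coeff_sub, coeff_add, coeff_C_mul, coeff_X_mul, z1, z2,
        Nat.add_sub_cancel, mul_zero, add_zero, sub_zero] at e'
      exact hI (mul_right_cancel₀ (hlead (m + 1)) (by linear_combination e'))
  refine ⟨hcs, fun n hn => ?_⟩
  obtain ⟨m, rfl⟩ : ∃ m, n = m + 2 := ⟨n - 2, by omega⟩
  have e := (h2 (m + 1) (by omega)).symm.trans (k2 (m + 1) (by omega))
  rw [hcs (m + 1 + 1) (by omega), sub_right_inj, Nat.add_sub_cancel] at e
  have hR : normalizedKernel ν m ≠ 0 := fun h0 => hlead m (by rw [h0, coeff_zero])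
  have e' := C_injective (mul_right_cancel₀ X_ne_zero (mul_right_cancel₀ hR e))
  exact_mod_cast mul_left_cancel₀ (by norm_num : (4 : ℂ) ≠ 0) e'

/-- Up to its leading coefficient, `R_n` is L-orthogonal for `(z - 1) dν`: on the circle
`z ^ (-n + s) (z - 1)` is the conjugate of `z ^ (n - s - 1) (1 - z)`, which is of degree at most
`n` and vanishes at `1`, so that the reproducing property applies. -/
lemma isMonicLOrthogonal_normalizedKernel (n : ℕ) :
    IsMonicLOrthogonal (fun f => ∫ z, f z * (z - 1) ∂ν) n
      (C ((∏ k ∈ Finset.Icc 1 n, (1 + Complex.I * (cCoeff ν k : ℂ)))⁻¹) *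
        normalizedKernel ν n) := by
  set a := (∏ k ∈ Finset.Icc 1 n, (1 + Complex.I * (cCoeff ν k : ℂ)))⁻¹ with ha
  have hdeg : (C a * normalizedKernel ν n).natDegree ≤ n :=
    (natDegree_C_mul_le _ _).trans (natDegree_normalizedKernel_le ν n)
  have hcoeff : (C a * normalizedKernel ν n).coeff n = 1 := by
    rw [coeff_C_mul, coeff_normalizedKernel_self hc hs, ha,
      inv_mul_cancel₀ (prod_one_add_I_mul_cCoeff_ne_zero ν n)]
  refine ⟨monic_of_natDegree_le_of_coeff_eq_one n hdeg hcoeff,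
    natDegree_eq_of_le_of_coeff_ne_zero hdeg (by rw [hcoeff]; exact one_ne_zero), ?_⟩
  intro s hsn
  have key : ∫ z, z ^ (-(n : ℤ) + (s : ℤ)) * (C a * normalizedKernel ν n).eval z * (z - 1) ∂ν =
      polyInner ν (C a * normalizedKernel ν n) (X ^ (n - s - 1) - X ^ (n - s)) := by
    unfold polyInner
    refine integral_congr_ae ?_
    filter_upwards [hc] with z hz
    have h1 : z * conj z = 1 := mul_conj_eq_one hz
    have hz0 : z ≠ 0 := by rintro rfl; simp at hz
    have h2 : conj z = z⁻¹ := eq_inv_of_mul_eq_one_right h1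
    obtain ⟨m, rfl⟩ : ∃ m, n = s + m + 1 := ⟨n - s - 1, by omega⟩
    have h3 : (-((s + m + 1 : ℕ) : ℤ) + (s : ℤ)) = -((m + 1 : ℕ) : ℤ) := by push_cast; ring
    have h4 : s + m + 1 - s - 1 = m := by omega
    have h5 : s + m + 1 - s = m + 1 := by omega
    rw [h3, h4, h5, zpow_neg, zpow_natCast]
    simp only [eval_sub, eval_pow, eval_X, map_sub, map_pow, h2, inv_pow]
    field_simp
    ring
  change ∫ z, z ^ (-(n : ℤ) + (s : ℤ)) * (C a * normalizedKernel ν n).eval z * (z - 1) ∂ν = 0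
  rw [key, normalizedKernel, polyInner_C_mul_left, polyInner_C_mul_left, polyInner_sub_right hc,
    polyInner_cdKernel_X_pow hc hs (by omega), polyInner_cdKernel_X_pow hc hs (by omega)]
  simp

end Kernel

/-! ### The modified measures -/

lemma measurable_modifiedDensity (q : ℂ) (t : ℝ) :
    Measurable fun z : ℂ => Real.exp (-t * (conj q * z + q / z).re) := by
  refine Real.measurable_exp.comp (measurable_const.mul (Complex.measurable_re.comp ?_))
  exact (measurable_const.mul measurable_id).add (measurable_const.div measurable_id)

/-- On the unit circle the exponent `conj q * z + q / z` is real. -/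
lemma ofReal_re_exponent (q : ℂ) {z : ℂ} (hz : ‖z‖ = 1) :
    (((conj q * z + q / z).re : ℝ) : ℂ) = conj q * z + q * conj z := by
  have h1 : z * conj z = 1 := mul_conj_eq_one hz
  have h2 : conj z = z⁻¹ := eq_inv_of_mul_eq_one_right h1
  rw [div_eq_mul_inv, ← h2]
  apply Complex.ext
  · simp
  · simp; ring

lemma abs_re_exponent_le (q : ℂ) {z : ℂ} (hz : ‖z‖ = 1) :
    |(conj q * z + q / z).re| ≤ 2 * ‖q‖ := by
  refine (Complex.abs_re_le_norm _).trans ((norm_add_le _ _).trans ?_)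
  rw [norm_mul, norm_div, hz, RCLike.norm_conj]
  linarith

section Modified

variable {μ : Measure ℂ}

lemma ae_circle_modifiedMeasure (hc : ∀ᵐ z ∂μ, ‖z‖ = 1) (q : ℂ) (t : ℝ) :
    ∀ᵐ z ∂(modifiedMeasure μ q t), ‖z‖ = 1 :=
  (withDensity_absolutelyContinuous μ _).ae_le hc

lemma support_modifiedMeasure_infinite (hs : μ.support.Infinite) (q : ℂ) (t : ℝ) :
    (modifiedMeasure μ q t).support.Infinite := by
  refine hs.mono (Measure.AbsolutelyContinuous.support_mono ?_)
  refine withDensity_absolutelyContinuous'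
    (measurable_modifiedDensity q t).ennreal_ofReal.aemeasurable ?_
  filter_upwards with z
  simpa using Real.exp_pos _

lemma integral_modifiedMeasure (q : ℂ) (t : ℝ) (f : ℂ → ℂ) :
    ∫ z, f z ∂(modifiedMeasure μ q t) =
      ∫ z, (Real.exp (-t * (conj q * z + q / z).re) : ℂ) * f z ∂μ := by
  rw [modifiedMeasure, integral_withDensity_eq_integral_toReal_smul
    (measurable_modifiedDensity q t).ennreal_ofReal (by simp)]
  congr 1
  ext z
  rw [ENNReal.toReal_ofReal (Real.exp_pos _).le, Complex.real_smul]

lemma momentFunctional_eq (hc : ∀ᵐ z ∂μ, ‖z‖ = 1) (q : ℂ) (t : ℝ) :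
    momentFunctional μ q t = fun f => ∫ z, f z * (z - 1) ∂(modifiedMeasure μ q t) := by
  ext f
  rw [integral_modifiedMeasure, momentFunctional]
  refine integral_congr_ae ?_
  filter_upwards [hc] with z hz
  have h := ofReal_re_exponent q hz
  have h1 : z * conj z = 1 := mul_conj_eq_one hz
  have h2 : conj z = z⁻¹ := eq_inv_of_mul_eq_one_right h1
  rw [h2, ← div_eq_mul_inv] at h
  push_cast
  rw [h]
  ring

variable [IsFiniteMeasure μ]

lemma isFiniteMeasure_modifiedMeasure (hc : ∀ᵐ z ∂μ, ‖z‖ = 1) (q : ℂ) (t : ℝ) :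
    IsFiniteMeasure (modifiedMeasure μ q t) := by
  refine isFiniteMeasure_withDensity_ofReal
    (Integrable.of_bound (measurable_modifiedDensity q t).aestronglyMeasurable
      (Real.exp (|t| * (2 * ‖q‖))) ?_).2
  filter_upwards [hc] with z hz
  rw [Real.norm_eq_abs, Real.abs_exp]
  refine Real.exp_le_exp.2 ((le_abs_self _).trans ?_)
  rw [abs_mul, abs_neg]
  exact mul_le_mul_of_nonneg_left (abs_re_exponent_le q hz) (abs_nonneg t)

/-- The moments of the modified measures, differentiated under the integral sign. -/
lemma hasDerivAt_polyInner_X_pow (hc : ∀ᵐ z ∂μ, ‖z‖ = 1) (q : ℂ) (i j : ℕ) (t : ℝ) :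
    HasDerivAt (fun s => polyInner (modifiedMeasure μ q s) (X ^ i) (X ^ j))
      (-(conj q * polyInner (modifiedMeasure μ q t) (X ^ (i + 1)) (X ^ j) +
        q * polyInner (modifiedMeasure μ q t) (X ^ i) (X ^ (j + 1)))) t := by
  have := isFiniteMeasure_modifiedMeasure hc q t
  have hcν := ae_circle_modifiedMeasure hc q t
  have hcont : Continuous fun z : ℂ => z ^ i * conj (z ^ j) := by fun_prop
  have hmeas : ∀ s : ℝ, AEStronglyMeasurable
      (fun z : ℂ => (Real.exp (-s * (conj q * z + q / z).re) : ℂ) * (z ^ i * conj (z ^ j))) μ :=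
    fun s => ((Complex.measurable_ofReal.comp (measurable_modifiedDensity q s)).mul
      hcont.measurable).aestronglyMeasurable
  have hφ : Measurable fun z : ℂ => (conj q * z + q / z).re :=
    Complex.measurable_re.comp
      ((measurable_const.mul measurable_id).add (measurable_const.div measurable_id))
  have hexp : ∀ s : ℝ, ∀ z : ℂ, ‖z‖ = 1 →
      ‖(Real.exp (-s * (conj q * z + q / z).re) : ℂ)‖ ≤ Real.exp (|s| * (2 * ‖q‖)) := by
    intro s z hz
    rw [Complex.norm_real, Real.norm_eq_abs, Real.abs_exp]
    refine Real.exp_le_exp.2 ((le_abs_self _).trans ?_)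
    rw [abs_mul, abs_neg]
    exact mul_le_mul_of_nonneg_left (abs_re_exponent_le q hz) (abs_nonneg s)
  have hg : ∀ z : ℂ, ‖z‖ = 1 → ‖z ^ i * conj (z ^ j)‖ = 1 := by
    intro z hz
    rw [norm_mul, RCLike.norm_conj, norm_pow, norm_pow, hz]
    simp
  have key := (hasDerivAt_integral_of_dominated_loc_of_deriv_le (μ := μ) (x₀ := t)
    (s := Metric.ball t 1)
    (F := fun s z => (Real.exp (-s * (conj q * z + q / z).re) : ℂ) * (z ^ i * conj (z ^ j)))
    (F' := fun s z => -((conj q * z + q / z).re : ℂ) *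
      ((Real.exp (-s * (conj q * z + q / z).re) : ℂ) * (z ^ i * conj (z ^ j))))
    (bound := fun _ => 2 * ‖q‖ * Real.exp ((|t| + 1) * (2 * ‖q‖)))
    (Metric.ball_mem_nhds t one_pos) (Filter.Eventually.of_forall hmeas) ?_ ?_ ?_
    (integrable_const _) ?_).2
  · unfold polyInner
    simp only [integral_modifiedMeasure, eval_pow, eval_X]
    refine key.congr_deriv (Eq.symm ?_)
    rw [← integral_const_mul, ← integral_const_mul, ← integral_add, ← integral_neg]
    · refine integral_congr_ae ?_
      filter_upwards [hc] with z hz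
      rw [ofReal_re_exponent q hz, map_pow, map_pow]
      ring
    · refine Integrable.const_mul (Integrable.of_bound ?_ (Real.exp (|t| * (2 * ‖q‖))) ?_) _
      · refine ((Complex.measurable_ofReal.comp (measurable_modifiedDensity q t)).mul
          ?_).aestronglyMeasurable
        exact (by fun_prop : Continuous fun z : ℂ => z ^ (i + 1) * conj (z ^ j)).measurable
      · filter_upwards [hc] with z hz
        rw [norm_mul, norm_mul, RCLike.norm_conj, norm_pow, norm_pow, hz]
        simpa using hexp t z hz
    · refine Integrable.const_mul (Integrable.of_bound ?_ (Real.exp (|t| * (2 * ‖q‖))) ?_) _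
      · refine ((Complex.measurable_ofReal.comp (measurable_modifiedDensity q t)).mul
          ?_).aestronglyMeasurable
        exact (by fun_prop : Continuous fun z : ℂ => z ^ i * conj (z ^ (j + 1))).measurable
      · filter_upwards [hc] with z hz
        rw [norm_mul, norm_mul, RCLike.norm_conj, norm_pow, norm_pow, hz]
        simpa using hexp t z hz
  · refine Integrable.of_bound (hmeas t) (Real.exp (|t| * (2 * ‖q‖))) ?_
    filter_upwards [hc] with z hz
    rw [norm_mul, hg z hz, mul_one]
    exact hexp t z hz
  · exact ((Complex.measurable_ofReal.comp hφ).neg.aestronglyMeasurable).mul (hmeas t)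
  · filter_upwards [hc] with z hz s hsb
    rw [norm_mul, norm_mul, hg z hz, mul_one, norm_neg, Complex.norm_real, Real.norm_eq_abs]
    refine mul_le_mul (abs_re_exponent_le q hz) ((hexp s z hz).trans (Real.exp_le_exp.2 ?_))
      (norm_nonneg _) (by positivity)
    refine mul_le_mul_of_nonneg_right ?_ (by positivity)
    rw [Metric.mem_ball, Real.dist_eq] at hsb
    have := abs_sub_abs_le_abs_sub s t
    linarith
  · filter_upwards [hc] with z hz s _
    have h1 : HasDerivAt (fun s : ℝ => Real.exp (-s * (conj q * z + q / z).re))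
        (Real.exp (-s * (conj q * z + q / z).re) * (-1 * (conj q * z + q / z).re)) s :=
      (((hasDerivAt_id s).neg).mul_const _).exp
    refine (h1.ofReal_comp.mul_const (z ^ i * conj (z ^ j))).congr_deriv ?_
    push_cast
    ring

/-- Differentiation of `⟨P_t, z ^ j⟩_t` for a family of polynomials of bounded degree with
differentiable coefficients. -/
lemma hasDerivAt_polyInner (hc : ∀ᵐ z ∂μ, ‖z‖ = 1) (q : ℂ) {P : ℝ → ℂ[X]} {P' : ℂ[X]} {n : ℕ}
    {t : ℝ} (hn : ∀ s, (P s).natDegree < n) (hn' : P'.natDegree < n)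
    (hP : ∀ k, HasDerivAt (fun s => (P s).coeff k) (P'.coeff k) t) (j : ℕ) :
    HasDerivAt (fun s => polyInner (modifiedMeasure μ q s) (P s) (X ^ j))
      (polyInner (modifiedMeasure μ q t) P' (X ^ j) -
        (conj q * polyInner (modifiedMeasure μ q t) (X * P t) (X ^ j) +
          q * polyInner (modifiedMeasure μ q t) (P t) (X ^ (j + 1)))) t := by
  have hfin := isFiniteMeasure_modifiedMeasure hc q
  have hcν := ae_circle_modifiedMeasure hc q
  have h1 : (fun s => polyInner (modifiedMeasure μ q s) (P s) (X ^ j)) = fun s =>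
      ∑ i ∈ Finset.range n, (P s).coeff i *
        polyInner (modifiedMeasure μ q s) (X ^ i) (X ^ j) := by
    ext s
    exact polyInner_eq_sum_coeff_left (hcν s) (hn s) _
  have h2 : X * P t = ∑ i ∈ Finset.range n, C ((P t).coeff i) * X ^ (i + 1) := by
    conv_lhs => rw [(P t).as_sum_range_C_mul_X_pow' (hn t), Finset.mul_sum]
    refine Finset.sum_congr rfl fun i _ => ?_
    ring
  rw [h1, h2, polyInner_sum_left (hcν t), polyInner_eq_sum_coeff_left (hcν t) hn',
    polyInner_eq_sum_coeff_left (hcν t) (hn t), Finset.mul_sum, Finset.mul_sum,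
    ← Finset.sum_add_distrib, ← Finset.sum_sub_distrib]
  refine (HasDerivAt.fun_sum fun i _ =>
    (hP i).mul (hasDerivAt_polyInner_X_pow hc q i j t)).congr_deriv ?_
  refine Finset.sum_congr rfl fun i _ => ?_
  rw [polyInner_C_mul_left]
  ring

end Modified

/-! ### The flow of the orthogonal polynomials -/

/-- A family of polynomials of degree `≤ n` with differentiable coefficients, the leading one of
which is constant, has a derivative of degree `< n`. -/
lemma exists_coeff_deriv {P : ℝ → ℂ[X]} {n : ℕ} {t : ℝ} {a : ℂ} (hn : ∀ s, (P s).natDegree ≤ n)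
    (ha : ∀ s, (P s).coeff n = a)
    (hP : ∀ k, DifferentiableAt ℝ (fun s => (P s).coeff k) t) :
    ∃ P' : ℂ[X], P'.degree < n ∧ ∀ k, HasDerivAt (fun s => (P s).coeff k) (P'.coeff k) t := by
  refine ⟨∑ i ∈ Finset.range n, C (deriv (fun s => (P s).coeff i) t) * X ^ i, ?_, fun k => ?_⟩
  · refine (degree_sum_le _ _).trans_lt ((Finset.sup_lt_iff (WithBot.bot_lt_coe n)).2
      fun i hi => ?_)
    refine (degree_C_mul_X_pow_le _ _).trans_lt (Nat.cast_lt.2 (Finset.mem_range.1 hi))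
  · simp only [finsetSum_coeff, coeff_C_mul, coeff_X_pow, mul_ite, mul_one, mul_zero,
      Finset.sum_ite_eq, Finset.mem_range]
    split_ifs with hk
    · exact (hP k).hasDerivAt
    · obtain rfl | hk' : k = n ∨ n < k := by omega
      · simpa [ha] using hasDerivAt_const t a
      · have : (fun s => (P s).coeff k) = fun _ => 0 := by
          ext s
          exact coeff_eq_zero_of_natDegree_lt ((hn s).trans_lt hk')
        rw [this]
        exact hasDerivAt_const t 0

section Flow

variable {μ : Measure ℂ} [IsFiniteMeasure μ] (hc : ∀ᵐ z ∂μ, ‖z‖ = 1) (hs : μ.support.Infinite)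
  (q : ℂ)
include hc hs

/-- By induction along the orthogonalization process, whose coefficients are quotients of the
inner products `⟨Φ_i, z ^ j⟩_t`. -/
lemma differentiableAt_coeff_monicOP (n k : ℕ) (t : ℝ) :
    DifferentiableAt ℝ (fun s => (monicOP (modifiedMeasure μ q s) n).coeff k) t := by
  have hfin := isFiniteMeasure_modifiedMeasure hc q
  have hcν := ae_circle_modifiedMeasure hc q
  have hsν := support_modifiedMeasure_infinite hs q
  induction n using Nat.strong_induction_on generalizing k with
  | _ n ih =>
    have h1 : ∀ i < n, ∀ j, DifferentiableAt ℝ (fun s => polyInner (modifiedMeasure μ q s)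
        (monicOP (modifiedMeasure μ q s) i) (X ^ j)) t := by
      intro i hi j
      obtain ⟨P', hP', hd⟩ := exists_coeff_deriv (n := i) (a := 1)
        (fun s => (natDegree_monicOP (modifiedMeasure μ q s) i).le)
        (fun s => coeff_monicOP_self (modifiedMeasure μ q s) i) (fun k => ih i hi k)
      exact (hasDerivAt_polyInner hc q
        (fun s => Nat.lt_succ_of_le (natDegree_monicOP (modifiedMeasure μ q s) i).le)
        (Nat.lt_succ_of_le (natDegree_le_of_degree_le hP'.le)) hd j).differentiableAt
    have h2 : (fun s => (monicOP (modifiedMeasure μ q s) n).coeff k) = fun s =>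
        (X ^ n : ℂ[X]).coeff k - ∑ i : Fin n,
          conj (polyInner (modifiedMeasure μ q s) (monicOP (modifiedMeasure μ q s) i) (X ^ n)) /
          polyInner (modifiedMeasure μ q s) (monicOP (modifiedMeasure μ q s) i) (X ^ (i : ℕ)) *
          (monicOP (modifiedMeasure μ q s) i).coeff k := by
      ext s
      conv_lhs => rw [monicOP_eq]
      simp only [coeff_sub, finsetSum_coeff, coeff_C_mul, conj_polyInner]
      congr 1
      refine Finset.sum_congr rfl fun i _ => ?_
      rw [polyInner_monicOP_of_monic (hcν s) (hsν s) (monic_X_pow _) (natDegree_X_pow _)]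
    rw [h2]
    refine (differentiableAt_const _).sub (DifferentiableAt.fun_sum fun i _ => ?_)
    refine DifferentiableAt.mul (DifferentiableAt.div ?_ (h1 i i.2 _) ?_) (ih i i.2 k)
    · exact (Complex.conjCLE.differentiableAt).comp t (h1 i i.2 n)
    · rw [polyInner_monicOP_of_monic (hcν t) (hsν t) (monic_X_pow _) (natDegree_X_pow _)]
      exact polyInner_self_ne_zero (hcν t) (hsν t) (monicOP_ne_zero _ _)

/-- The derivative of `Φ_{n+1}` with respect to `t` is
`(1 - |a_n|²) (q Φ_n + conj q * conj a_{n+1} * Φ_n^*)`: differentiating `⟨Φ_{n+1}, z ^ k⟩ = 0`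
gives the inner products of the derivative with `1, ..., z ^ n`, and they are those of the right
hand side. -/
lemma hasDerivAt_coeff_monicOP_succ (n k : ℕ) (t : ℝ) :
    HasDerivAt (fun s => (monicOP (modifiedMeasure μ q s) (n + 1)).coeff k)
      ((C ((1 - ‖verblunsky (modifiedMeasure μ q t) n‖ ^ 2 : ℝ) : ℂ) *
        (C q * monicOP (modifiedMeasure μ q t) n +
          C (conj q * conj (verblunsky (modifiedMeasure μ q t) (n + 1))) *
            reciprocalOP (modifiedMeasure μ q t) n)).coeff k) t := by
  have hfin := isFiniteMeasure_modifiedMeasure hc q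
  have hcν := ae_circle_modifiedMeasure hc q
  have hsν := support_modifiedMeasure_infinite hs q
  obtain ⟨P', hP', hd⟩ := exists_coeff_deriv (n := n + 1) (a := 1)
    (fun s => (natDegree_monicOP (modifiedMeasure μ q s) (n + 1)).le)
    (fun s => coeff_monicOP_self (modifiedMeasure μ q s) (n + 1))
    (fun k => differentiableAt_coeff_monicOP hc hs q (n + 1) k t)
  have hinner : ∀ j < n + 1, polyInner (modifiedMeasure μ q t) P' (X ^ j) =
      conj q * polyInner (modifiedMeasure μ q t)
        (X * monicOP (modifiedMeasure μ q t) (n + 1)) (X ^ j) +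
      q * polyInner (modifiedMeasure μ q t)
        (monicOP (modifiedMeasure μ q t) (n + 1)) (X ^ (j + 1)) := by
    intro j hj
    have h1 := hasDerivAt_polyInner hc q
      (fun s => Nat.lt_succ_of_le (natDegree_monicOP (modifiedMeasure μ q s) (n + 1)).le)
      (Nat.lt_succ_of_le (natDegree_le_of_degree_le hP'.le)) hd j
    have h2 : (fun s => polyInner (modifiedMeasure μ q s)
        (monicOP (modifiedMeasure μ q s) (n + 1)) (X ^ j)) = fun _ => 0 := by
      ext s
      exact polyInner_monicOP_X_pow_of_lt (hcν s) (hsν s) hj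
    rw [h2] at h1
    exact sub_eq_zero.1 (h1.unique (hasDerivAt_const t 0))
  suffices h : P' = C ((1 - ‖verblunsky (modifiedMeasure μ q t) n‖ ^ 2 : ℝ) : ℂ) *
        (C q * monicOP (modifiedMeasure μ q t) n +
          C (conj q * conj (verblunsky (modifiedMeasure μ q t) (n + 1))) *
            reciprocalOP (modifiedMeasure μ q t) n) by
    rw [← h]; exact hd k
  have hcν := hcν t
  have hsν := hsν t
  have hfin := hfin t
  clear hd
  generalize modifiedMeasure μ q t = ν at *
  have hN : polyInner ν (monicOP ν (n + 1)) (monicOP ν (n + 1)) =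
      ((1 - ‖verblunsky ν n‖ ^ 2 : ℝ) : ℂ) * polyInner ν (monicOP ν n) (monicOP ν n) := by
    rw [polyInner_self, polyInner_self, integral_norm_sq_monicOP_succ hcν hsν]
    push_cast
    rfl
  rw [← sub_eq_zero]
  refine eq_zero_of_polyInner_X_pow_eq_zero hcν hsν (n := n + 1) ?_ fun j hj => ?_
  · refine (degree_sub_le _ _).trans_lt (max_lt hP' (degree_C_mul_lt ?_ _))
    refine (degree_add_le _ _).trans_lt (max_lt (degree_C_mul_lt ?_ _) (degree_C_mul_lt ?_ _))
    · rw [degree_monicOP]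
      exact Nat.cast_lt.2 (Nat.lt_succ_self n)
    · exact degree_le_natDegree.trans_lt
        (Nat.cast_lt.2 (Nat.lt_succ_of_le (natDegree_reciprocalOP_le ν n)))
  · rw [polyInner_sub_left hcν, hinner j hj, polyInner_C_mul_left, polyInner_add_left hcν,
      polyInner_C_mul_left, polyInner_C_mul_left]
    have e1 : polyInner ν (X * monicOP ν (n + 1)) (X ^ j) =
        conj (verblunsky ν (n + 1)) * (((1 - ‖verblunsky ν n‖ ^ 2 : ℝ) : ℂ) *
          polyInner ν (reciprocalOP ν n) (X ^ j)) := by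
      rcases Nat.eq_zero_or_pos j with rfl | hj0
      · have h3 : X * monicOP ν (n + 1) = monicOP ν (n + 1 + 1) -
            C (-conj (verblunsky ν (n + 1))) * reciprocalOP ν (n + 1) := by
          rw [monicOP_succ hcν hsν (n + 1)]; simp
        rw [h3, polyInner_sub_left hcν, polyInner_monicOP_X_pow_of_lt hcν hsν (by omega),
          polyInner_C_mul_left, pow_zero, polyInner_reciprocalOP_one hcν hsν,
          polyInner_reciprocalOP_one hcν hsν, hN]
        ring
      · rw [polyInner_reciprocalOP_X_pow_of_pos hcν hsν (by omega) hj0]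
        obtain ⟨i, rfl⟩ : ∃ i, j = i + 1 := ⟨j - 1, by omega⟩
        rw [pow_succ', polyInner_X_mul_X_mul hcν,
          polyInner_monicOP_X_pow_of_lt hcν hsν (by omega)]
        ring
    have e2 : polyInner ν (monicOP ν (n + 1)) (X ^ (j + 1)) =
        ((1 - ‖verblunsky ν n‖ ^ 2 : ℝ) : ℂ) * polyInner ν (monicOP ν n) (X ^ j) := by
      obtain rfl | hjn : j = n ∨ j < n := by omega
      · rw [polyInner_monicOP_of_monic hcν hsν (monic_X_pow _) (natDegree_X_pow _),
          polyInner_monicOP_of_monic hcν hsν (monic_X_pow _) (natDegree_X_pow _), hN]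
      · rw [polyInner_monicOP_X_pow_of_lt hcν hsν (by omega),
          polyInner_monicOP_X_pow_of_lt hcν hsν hjn, mul_zero]
    rw [e1, e2]
    ring

lemma hasDerivAt_eval_monicOP_succ (n : ℕ) (t : ℝ) (z : ℂ) :
    HasDerivAt (fun s => (monicOP (modifiedMeasure μ q s) (n + 1)).eval z)
      ((1 - ‖verblunsky (modifiedMeasure μ q t) n‖ ^ 2 : ℝ) *
        (q * (monicOP (modifiedMeasure μ q t) n).eval z +
          conj q * conj (verblunsky (modifiedMeasure μ q t) (n + 1)) *
            (reciprocalOP (modifiedMeasure μ q t) n).eval z)) t := by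
  set D := C ((1 - ‖verblunsky (modifiedMeasure μ q t) n‖ ^ 2 : ℝ) : ℂ) *
        (C q * monicOP (modifiedMeasure μ q t) n +
          C (conj q * conj (verblunsky (modifiedMeasure μ q t) (n + 1))) *
            reciprocalOP (modifiedMeasure μ q t) n) with hD
  have hdeg : D.natDegree < n + 2 := by
    refine Nat.lt_succ_of_le (natDegree_C_mul_le _ _ |>.trans (natDegree_add_le_of_degree_le
      ((natDegree_C_mul_le _ _).trans ?_) ((natDegree_C_mul_le _ _).trans ?_)))
    · rw [natDegree_monicOP]; omega
    · exact (natDegree_reciprocalOP_le _ n).trans (Nat.le_succ n)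
  have h1 : (fun s => (monicOP (modifiedMeasure μ q s) (n + 1)).eval z) = fun s =>
      ∑ i ∈ Finset.range (n + 2), (monicOP (modifiedMeasure μ q s) (n + 1)).coeff i * z ^ i := by
    ext s
    exact eval_eq_sum_range' (by rw [natDegree_monicOP]; omega) z
  have h2 : D.eval z = (1 - ‖verblunsky (modifiedMeasure μ q t) n‖ ^ 2 : ℝ) *
        (q * (monicOP (modifiedMeasure μ q t) n).eval z +
          conj q * conj (verblunsky (modifiedMeasure μ q t) (n + 1)) *
            (reciprocalOP (modifiedMeasure μ q t) n).eval z) := by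
    simp [hD]
  rw [h1, ← h2, eval_eq_sum_range' hdeg z]
  exact HasDerivAt.fun_sum fun i _ =>
    (hasDerivAt_coeff_monicOP_succ hc hs q n i t).mul_const (z ^ i)

end Flow

/-! ### The flow of the rotated Verblunsky coefficients -/

/-- The vector field of the flow of the rotated Verblunsky coefficients: the derivative of `b_n`
when `b_{n-1} = β`, `b_n = b` and `b_{n+1} = k`. For `n = 0` the role of `b_{-1}` is played
by `-1`. -/
noncomputable def rotFlow (q β b k : ℂ) : ℂ :=
  (1 - b * conj b) * (conj q * (β * ((1 - conj β) / (1 - β))) -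
      q * (k * ((1 - b) / (1 - conj b)))) +
    b * ((1 - β * conj β) * (q * (1 - b) * (1 / (1 - conj β)) -
      conj q * (1 - conj b) * (1 / (1 - β))))

lemma one_sub_ne_zero_of_norm_lt_one {b : ℂ} (hb : ‖b‖ < 1) : 1 - b ≠ 0 := by
  intro h
  rw [← sub_eq_zero.1 h, norm_one] at hb
  exact lt_irrefl _ hb

lemma one_sub_conj_ne_zero_of_norm_lt_one {b : ℂ} (hb : ‖b‖ < 1) : 1 - conj b ≠ 0 :=
  one_sub_ne_zero_of_norm_lt_one (by rwa [RCLike.norm_conj])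

lemma ofReal_one_sub_norm_sq (a : ℂ) : ((1 - ‖a‖ ^ 2 : ℝ) : ℂ) = 1 - a * conj a := by
  rw [Complex.mul_conj, Complex.normSq_eq_norm_sq]
  push_cast
  rfl

lemma verblunsky_eq {ν : Measure ℂ} [IsFiniteMeasure ν] (hc : ∀ᵐ z ∂ν, ‖z‖ = 1)
    (hs : ν.support.Infinite) (n : ℕ) : verblunsky ν n =
      rotVerblunsky ν n * conj ((monicOP ν n).eval 1) / (monicOP ν n).eval 1 := by
  rw [eq_div_iff (eval_one_monicOP_ne_zero hc hs n), rotVerblunsky_mul_conj_eval_one hc hs]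

section RotatedFlow

variable {μ : Measure ℂ} [IsFiniteMeasure μ] (hc : ∀ᵐ z ∂μ, ‖z‖ = 1) (hs : μ.support.Infinite)
  (q : ℂ)
include hc hs

/-- The Schur flow (Ablowitz-Ladik) equations. -/
lemma hasDerivAt_verblunsky (n : ℕ) (t : ℝ) :
    HasDerivAt (fun s => verblunsky (modifiedMeasure μ q s) n)
      (-((1 - verblunsky (modifiedMeasure μ q t) n * conj (verblunsky (modifiedMeasure μ q t) n)) *
        (conj q * conj ((monicOP (modifiedMeasure μ q t) n).eval 0) +
          q * verblunsky (modifiedMeasure μ q t) (n + 1)))) t := by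
  have h := ((hasDerivAt_eval_monicOP_succ hc hs q n t 0).star).neg
  refine HasDerivAt.congr_deriv h ?_
  rw [eval_zero_reciprocalOP, ofReal_one_sub_norm_sq]
  simp only [Complex.star_def, map_mul, map_add, map_sub, map_one, Complex.conj_conj]
  ring

/-- The first equation. As `ρ_0 = 1` and `Φ_0(0) = 1 = -conj a_{-1}`, it is the general one with
`b_{-1} = -1`. -/
lemma hasDerivAt_rotVerblunsky_zero (t : ℝ) :
    HasDerivAt (fun s => rotVerblunsky (modifiedMeasure μ q s) 0)
      (rotFlow q (-1) (rotVerblunsky (modifiedMeasure μ q t) 0)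
        (rotVerblunsky (modifiedMeasure μ q t) 1)) t := by
  have hfin := isFiniteMeasure_modifiedMeasure hc q t
  have hcν := ae_circle_modifiedMeasure hc q t
  have hsν := support_modifiedMeasure_infinite hs q t
  have h0 : ∀ s, rotVerblunsky (modifiedMeasure μ q s) 0 =
      verblunsky (modifiedMeasure μ q s) 0 := fun s => by
    rw [rotVerblunsky, rho_eq, monicOP_zero]
    simp
  have h1 := hasDerivAt_verblunsky hc hs q 0 t
  have h2 := verblunsky_eq hcν hsν 1
  rw [eval_one_monicOP_succ_eq_mul hcν hsν] at h2
  simp only [← h0, zero_add] at h1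
  refine h1.congr_deriv ?_
  rw [h2]
  simp only [monicOP_zero, eval_one, map_one, map_sub, map_mul, Complex.conj_conj, rotFlow, map_neg]
  ring

/-- The general equation, from the derivatives of `Φ_{n+1}(1)` and `a_{n+1}`. All quantities are
expressed through `v = Φ_n(1)` and `b_n`, `b_{n+1}`, `b_{n+2}`; then `v` cancels. -/
lemma hasDerivAt_rotVerblunsky_succ (n : ℕ) (t : ℝ) :
    HasDerivAt (fun s => rotVerblunsky (modifiedMeasure μ q s) (n + 1))
      (rotFlow q (rotVerblunsky (modifiedMeasure μ q t) n)
        (rotVerblunsky (modifiedMeasure μ q t) (n + 1))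
        (rotVerblunsky (modifiedMeasure μ q t) (n + 2))) t := by
  have hfin := isFiniteMeasure_modifiedMeasure hc q t
  have hcν := ae_circle_modifiedMeasure hc q t
  have hsν := support_modifiedMeasure_infinite hs q t
  have hu := hasDerivAt_eval_monicOP_succ hc hs q n t 1
  have ha := hasDerivAt_verblunsky hc hs q (n + 1) t
  have hρ := ((hu.div hu.star (conj_eval_one_monicOP_ne_zero hcν hsν (n + 1))).mul ha)
  have h0 : (fun s => rotVerblunsky (modifiedMeasure μ q s) (n + 1)) =
      (fun s => (monicOP (modifiedMeasure μ q s) (n + 1)).eval 1 /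
        star ((monicOP (modifiedMeasure μ q s) (n + 1)).eval 1)) *
        fun s => verblunsky (modifiedMeasure μ q s) (n + 1) := by
    ext s
    rw [rotVerblunsky, rho_eq]
    rfl
  rw [h0]
  refine hρ.congr_deriv ?_
  have e1 := verblunsky_eq hcν hsν n
  have e2 := verblunsky_eq hcν hsν (n + 1)
  have e3 := verblunsky_eq hcν hsν (n + 2)
  have hβ := norm_rotVerblunsky_lt_one hcν hsν n
  have hb := norm_rotVerblunsky_lt_one hcν hsν (n + 1)
  have e4 : conj ((monicOP (modifiedMeasure μ q t) (n + 1)).eval 0) =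
      -verblunsky (modifiedMeasure μ q t) n := by simp [verblunsky]
  have hv := eval_one_monicOP_ne_zero hcν hsν n
  have hw := conj_eval_one_monicOP_ne_zero hcν hsν n
  rw [ofReal_one_sub_norm_sq, eval_one_reciprocalOP, e4]
  simp only [Complex.star_def, Pi.div_apply]
  rw [e1, e2, e3, eval_one_monicOP_succ_eq_mul hcν hsν (n + 1),
    eval_one_monicOP_succ_eq_mul hcν hsν n, rotFlow]
  generalize (monicOP (modifiedMeasure μ q t) n).eval 1 = v at *
  generalize rotVerblunsky (modifiedMeasure μ q t) n = β at *
  generalize rotVerblunsky (modifiedMeasure μ q t) (n + 1) = b at *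
  generalize rotVerblunsky (modifiedMeasure μ q t) (n + 2) = k at *
  have n1 := one_sub_ne_zero_of_norm_lt_one hβ
  have n2 := one_sub_conj_ne_zero_of_norm_lt_one hβ
  have n3 := one_sub_ne_zero_of_norm_lt_one hb
  have n4 := one_sub_conj_ne_zero_of_norm_lt_one hb
  simp only [map_mul, map_sub, map_add, map_div₀, map_one, Complex.conj_conj]
  generalize conj v = w at *
  generalize conj β = β' at *
  generalize conj b = b' at *
  generalize conj q = q' at *
  field_simp
  ring

end RotatedFlow

/-! ### The lattice equations -/

/-- The right hand side of the equation for `c_n`, in terms of `G = g_{n-1}`, `C = c_{n-1}`,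
`g = g_n`, `c = c_n`, `γ = g_{n+1}`, `e = c_{n+1}`. -/
noncomputable def cFlow (q : ℂ) (G C g c γ e : ℝ) : ℝ :=
  4 * q.re * ((1 - G) * g * (c + C) / (1 + C ^ 2) - (1 - g) * γ * (c + e) / (1 + e ^ 2)) +
    4 * q.im * ((1 - G) * g * (1 - c * C) / (1 + C ^ 2) -
      (1 - g) * γ * (1 - c * e) / (1 + e ^ 2))

/-- The derivative of `g_n`, in the same variables. -/
noncomputable def gFlow (q : ℂ) (G C g c γ e : ℝ) : ℝ :=
  -4 * g * (1 - g) * (q.re * ((1 - G) / (1 + C ^ 2) - 1 / (1 + c ^ 2) + γ / (1 + e ^ 2)) +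
    q.im * (-((1 - G) * C / (1 + C ^ 2)) + c / (1 + c ^ 2) - γ * e / (1 + e ^ 2)))

/-- The number `b` with the parameters `g` and `c`, that is `b = 1 - 2 g / (1 - i c)`. -/
noncomputable def rotOfParams (g c : ℝ) : ℂ :=
  ⟨1 - 2 * g / (1 + c ^ 2), -(2 * g * c / (1 + c ^ 2))⟩

lemma one_sub_rotOfParams (g c : ℝ) :
    1 - rotOfParams g c = (2 * g / (1 + c ^ 2) : ℝ) * (1 + Complex.I * c) := by
  apply Complex.ext
  · rw [Complex.re_ofReal_mul]
    simp [rotOfParams]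
  · rw [Complex.im_ofReal_mul]
    simp [rotOfParams]
    ring

lemma one_sub_conj_rotOfParams (g c : ℝ) :
    1 - conj (rotOfParams g c) = (2 * g / (1 + c ^ 2) : ℝ) * (1 - Complex.I * c) := by
  have h := congrArg conj (one_sub_rotOfParams g c)
  rw [map_mul, Complex.conj_ofReal] at h
  simpa only [map_sub, map_add, map_mul, map_one, Complex.conj_I, Complex.conj_ofReal, neg_mul,
    ← sub_eq_add_neg] using h

lemma one_sub_div_one_sub_conj_rotOfParams {g : ℝ} (hg : g ≠ 0) (c : ℝ) :
    (1 - rotOfParams g c) / (1 - conj (rotOfParams g c)) =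
      ⟨(1 - c ^ 2) / (1 + c ^ 2), 2 * c / (1 + c ^ 2)⟩ := by
  have h0 : (1 + c ^ 2 : ℝ) ≠ 0 := by positivity
  have h1 : ((2 * g / (1 + c ^ 2) : ℝ) : ℂ) ≠ 0 := by
    exact_mod_cast div_ne_zero (mul_ne_zero two_ne_zero hg) h0
  have h2 : (1 - Complex.I * c : ℂ) ≠ 0 := fun h => by simpa using congrArg Complex.re h
  rw [one_sub_rotOfParams, one_sub_conj_rotOfParams, mul_div_mul_left _ _ h1, div_eq_iff h2]
  apply Complex.ext
  · simp; field_simp; ring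
  · simp; field_simp; ring

lemma one_sub_conj_div_one_sub_rotOfParams {g : ℝ} (hg : g ≠ 0) (c : ℝ) :
    (1 - conj (rotOfParams g c)) / (1 - rotOfParams g c) =
      ⟨(1 - c ^ 2) / (1 + c ^ 2), -(2 * c / (1 + c ^ 2))⟩ := by
  have h := congrArg conj (one_sub_div_one_sub_conj_rotOfParams hg c)
  rw [map_div₀, map_sub, map_sub, map_one, Complex.conj_conj] at h
  exact h

lemma one_div_one_sub_rotOfParams {g : ℝ} (hg : g ≠ 0) (c : ℝ) :
    1 / (1 - rotOfParams g c) = ⟨1 / (2 * g), -(c / (2 * g))⟩ := by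
  have h0 : (1 + c ^ 2 : ℝ) ≠ 0 := by positivity
  have h1 : ((2 * g / (1 + c ^ 2) : ℝ) : ℂ) ≠ 0 := by
    exact_mod_cast div_ne_zero (mul_ne_zero two_ne_zero hg) h0
  have h2 : (1 + Complex.I * c : ℂ) ≠ 0 := fun h => by simpa using congrArg Complex.re h
  rw [one_sub_rotOfParams, div_eq_iff (mul_ne_zero h1 h2)]
  apply Complex.ext
  · simp [-Complex.ofReal_div, -Complex.ofReal_mul]; field_simp
  · simp [-Complex.ofReal_div, -Complex.ofReal_mul]; field_simp; ring

lemma one_div_one_sub_conj_rotOfParams {g : ℝ} (hg : g ≠ 0) (c : ℝ) :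
    1 / (1 - conj (rotOfParams g c)) = ⟨1 / (2 * g), c / (2 * g)⟩ := by
  have h := congrArg conj (one_div_one_sub_rotOfParams hg c)
  rw [map_div₀, map_sub, map_one] at h
  rw [h]
  apply Complex.ext <;> simp

lemma one_sub_mul_conj_rotOfParams (g c : ℝ) :
    1 - rotOfParams g c * conj (rotOfParams g c) = (4 * g * (1 - g) / (1 + c ^ 2) : ℝ) := by
  have h0 : (1 + c ^ 2 : ℝ) ≠ 0 := by positivity
  rw [Complex.mul_conj, Complex.normSq_apply, rotOfParams]
  norm_cast
  field_simp
  ring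

/-- The vector field `rotFlow` in real parameters. With `x = 2 g / (1 + c²)`, so that
`b = 1 - x - i x c`, the right hand sides are the solution `(ḃ.re, ḃ.im)` of the linear equations
`ċ x = c ḃ.re - ḃ.im` and `2 ġ = (c² - 1) ḃ.re - 2 c ḃ.im`. -/
lemma rotFlow_rotOfParams_re_im (q : ℂ) {G C g c γ e : ℝ} (hG : G ≠ 0) (hg : g ≠ 0) :
    (rotFlow q (rotOfParams G C) (rotOfParams g c) (rotOfParams γ e)).re =
      2 * (c * (2 * g / (1 + c ^ 2)) * cFlow q G C g c γ e - gFlow q G C g c γ e) / (1 + c ^ 2) ∧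
    (rotFlow q (rotOfParams G C) (rotOfParams g c) (rotOfParams γ e)).im =
      c * (2 * (c * (2 * g / (1 + c ^ 2)) * cFlow q G C g c γ e - gFlow q G C g c γ e) /
        (1 + c ^ 2)) - 2 * g / (1 + c ^ 2) * cFlow q G C g c γ e := by
  have h1 : (1 + c ^ 2 : ℝ) ≠ 0 := by positivity
  have h2 : (1 + C ^ 2 : ℝ) ≠ 0 := by positivity
  have h3 : (1 + e ^ 2 : ℝ) ≠ 0 := by positivity
  rw [rotFlow, one_sub_mul_conj_rotOfParams, one_sub_mul_conj_rotOfParams,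
    one_sub_conj_div_one_sub_rotOfParams hG, one_sub_div_one_sub_conj_rotOfParams hg,
    one_div_one_sub_rotOfParams hG, one_div_one_sub_conj_rotOfParams hG, one_sub_rotOfParams,
    one_sub_conj_rotOfParams, cFlow, gFlow, rotOfParams, rotOfParams, rotOfParams]
  simp only [Complex.add_re, Complex.mul_re, Complex.sub_re, Complex.add_im, Complex.mul_im,
    Complex.sub_im, Complex.ofReal_re, Complex.ofReal_im, Complex.conj_re, Complex.conj_im,
    Complex.one_re, Complex.one_im, Complex.I_re, Complex.I_im]
  constructor
  · field_simp
    ring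
  · field_simp
    ring

/-- If `b` moves by `rotFlow`, then its parameters `c` and `g` move by `cFlow` and `gFlow`. -/
lemma hasDerivAt_params {b : ℝ → ℂ} {q : ℂ} {G C g c γ e t : ℝ} (hG : G ≠ 0) (hg : g ≠ 0)
    (hbt : b t = rotOfParams g c)
    (hb : HasDerivAt b (rotFlow q (rotOfParams G C) (rotOfParams g c) (rotOfParams γ e)) t) :
    HasDerivAt (fun s => (b s).im / ((b s).re - 1)) (cFlow q G C g c γ e) t ∧
    HasDerivAt (fun s => 1 / 2 * (‖1 - b s‖ ^ 2 / (1 - (b s).re))) (gFlow q G C g c γ e) t := by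
  have h1 : (1 + c ^ 2 : ℝ) ≠ 0 := by positivity
  have hre : HasDerivAt (fun s => (b s).re) _ t :=
    (Complex.reCLM.hasFDerivAt (x := b t)).comp_hasDerivAt t hb
  have him : HasDerivAt (fun s => (b s).im) _ t :=
    (Complex.imCLM.hasFDerivAt (x := b t)).comp_hasDerivAt t hb
  simp only [Complex.reCLM_apply, Complex.imCLM_apply, (rotFlow_rotOfParams_re_im q hG hg).1,
    (rotFlow_rotOfParams_re_im q hG hg).2] at hre him
  have vre : (b t).re = 1 - 2 * g / (1 + c ^ 2) := by rw [hbt, rotOfParams]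
  have vim : (b t).im = -(2 * g * c / (1 + c ^ 2)) := by rw [hbt, rotOfParams]
  have hx : 2 * g / (1 + c ^ 2) ≠ 0 := div_ne_zero (mul_ne_zero two_ne_zero hg) h1
  have hne : (b t).re - 1 ≠ 0 := by rw [vre]; simpa using hx
  have hne' : 1 - (b t).re ≠ 0 := by rw [vre]; simpa using hx
  generalize cFlow q G C g c γ e = c' at *
  generalize gFlow q G C g c γ e = g' at *
  constructor
  · refine (him.div (hre.sub_const 1) hne).congr_deriv ?_
    rw [vre, vim]
    rw [vre] at hne
    field_simp
    ring
  · have hfun : (fun s => 1 / 2 * (‖1 - b s‖ ^ 2 / (1 - (b s).re))) = fun s =>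
        1 / 2 * (((1 - (b s).re) * (1 - (b s).re) + (b s).im * (b s).im) / (1 - (b s).re)) := by
      ext s
      rw [← Complex.normSq_eq_norm_sq, Complex.normSq_apply]
      simp
    rw [hfun]
    refine (((((hre.const_sub 1).mul (hre.const_sub 1)).add (him.mul him)).div (hre.const_sub 1)
      hne').const_mul (1 / 2)).congr_deriv ?_
    simp only [Pi.add_apply, Pi.mul_apply, vre, vim]
    rw [vre] at hne'
    field_simp
    ring

lemma gParam_succ_pos {ν : Measure ℂ} [IsFiniteMeasure ν] (hc : ∀ᵐ z ∂ν, ‖z‖ = 1)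
    (hs : ν.support.Infinite) (n : ℕ) : 0 < gParam ν (n + 1) := by
  rw [gParam_succ]
  have h1 := one_sub_re_rotVerblunsky_pos hc hs n
  have h2 := norm_pos_iff.2 (one_sub_ne_zero_of_norm_lt_one (norm_rotVerblunsky_lt_one hc hs n))
  positivity

/-- `b_n` is recovered from the parameters `g_{n+1}` and `c_{n+1}`. -/
lemma rotVerblunsky_eq_rotOfParams {ν : Measure ℂ} [IsFiniteMeasure ν] (hc : ∀ᵐ z ∂ν, ‖z‖ = 1)
    (hs : ν.support.Infinite) (n : ℕ) :
    rotVerblunsky ν n = rotOfParams (gParam ν (n + 1)) (cCoeff ν (n + 1)) := by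
  have h1 := one_sub_re_rotVerblunsky_pos hc hs n
  have h2 : (rotVerblunsky ν n).im = -(cCoeff ν (n + 1) * (1 - (rotVerblunsky ν n).re)) := by
    have : (rotVerblunsky ν n).re - 1 ≠ 0 := by linarith
    rw [cCoeff_succ, div_mul_eq_mul_div, ← neg_div, eq_div_iff this]
    ring
  have h3 : gParam ν (n + 1) =
      (1 - (rotVerblunsky ν n).re) * (1 + cCoeff ν (n + 1) ^ 2) / 2 := by
    rw [gParam_succ, ← Complex.normSq_eq_norm_sq, Complex.normSq_apply, Complex.sub_im,
      Complex.sub_re, Complex.one_re, Complex.one_im, h2]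
    field_simp
    ring
  have h4 : (1 + cCoeff ν (n + 1) ^ 2 : ℝ) ≠ 0 := by positivity
  apply Complex.ext
  · rw [rotOfParams, h3]
    field_simp
    ring
  · rw [rotOfParams, h3, h2]
    field_simp

section Lattice

variable {μ : Measure ℂ} [IsFiniteMeasure μ] (hc : ∀ᵐ z ∂μ, ‖z‖ = 1) (hs : μ.support.Infinite)
  (q : ℂ)
include hc hs

/-- The equations for `c_1` and `g_1`. The value `b_{-1} = -1` has the parameters `g = 1` and
`c = 0`. -/
lemma hasDerivAt_cCoeff_gParam_one (t : ℝ) :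
    HasDerivAt (fun s => cCoeff (modifiedMeasure μ q s) 1)
      (cFlow q 1 0 (gParam (modifiedMeasure μ q t) 1) (cCoeff (modifiedMeasure μ q t) 1)
        (gParam (modifiedMeasure μ q t) 2) (cCoeff (modifiedMeasure μ q t) 2)) t ∧
    HasDerivAt (fun s => gParam (modifiedMeasure μ q s) 1)
      (gFlow q 1 0 (gParam (modifiedMeasure μ q t) 1) (cCoeff (modifiedMeasure μ q t) 1)
        (gParam (modifiedMeasure μ q t) 2) (cCoeff (modifiedMeasure μ q t) 2)) t := by
  have hfin := isFiniteMeasure_modifiedMeasure hc q t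
  have hcν := ae_circle_modifiedMeasure hc q t
  have hsν := support_modifiedMeasure_infinite hs q t
  have hb := hasDerivAt_rotVerblunsky_zero hc hs q t
  have h1 : (-1 : ℂ) = rotOfParams 1 0 := by
    apply Complex.ext <;> norm_num [rotOfParams]
  rw [h1, rotVerblunsky_eq_rotOfParams hcν hsν 0, rotVerblunsky_eq_rotOfParams hcν hsν 1] at hb
  exact hasDerivAt_params one_ne_zero (gParam_succ_pos hcν hsν 0).ne'
    (rotVerblunsky_eq_rotOfParams hcν hsν 0) hb

lemma hasDerivAt_cCoeff_gParam_add_two (n : ℕ) (t : ℝ) :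
    HasDerivAt (fun s => cCoeff (modifiedMeasure μ q s) (n + 2))
      (cFlow q (gParam (modifiedMeasure μ q t) (n + 1)) (cCoeff (modifiedMeasure μ q t) (n + 1))
        (gParam (modifiedMeasure μ q t) (n + 2)) (cCoeff (modifiedMeasure μ q t) (n + 2))
        (gParam (modifiedMeasure μ q t) (n + 3)) (cCoeff (modifiedMeasure μ q t) (n + 3))) t ∧
    HasDerivAt (fun s => gParam (modifiedMeasure μ q s) (n + 2))
      (gFlow q (gParam (modifiedMeasure μ q t) (n + 1)) (cCoeff (modifiedMeasure μ q t) (n + 1))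
        (gParam (modifiedMeasure μ q t) (n + 2)) (cCoeff (modifiedMeasure μ q t) (n + 2))
        (gParam (modifiedMeasure μ q t) (n + 3)) (cCoeff (modifiedMeasure μ q t) (n + 3))) t := by
  have hfin := isFiniteMeasure_modifiedMeasure hc q t
  have hcν := ae_circle_modifiedMeasure hc q t
  have hsν := support_modifiedMeasure_infinite hs q t
  have hb := hasDerivAt_rotVerblunsky_succ hc hs q n t
  rw [rotVerblunsky_eq_rotOfParams hcν hsν n, rotVerblunsky_eq_rotOfParams hcν hsν (n + 1),
    rotVerblunsky_eq_rotOfParams hcν hsν (n + 2)] at hb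
  exact hasDerivAt_params (gParam_succ_pos hcν hsν n).ne' (gParam_succ_pos hcν hsν (n + 1)).ne'
    (rotVerblunsky_eq_rotOfParams hcν hsν (n + 1)) hb

end Lattice

/-- The equation for `d = (1 - G) g`, from those for `G = g_{n-1}` and `g = g_n`. -/
lemma dFlow_eq (q : ℂ) (G₀ C₀ G C g c γ e : ℝ) :
    -gFlow q G₀ C₀ G C g c * g + (1 - G) * gFlow q G C g c γ e =
      4 * q.re * ((1 - G) * g * ((1 - G₀) * G) / (1 + C₀ ^ 2)
          - (1 - G) * g * ((1 - g) * γ) / (1 + e ^ 2)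
          + (1 - G) * g * (1 - (1 - G) * g) * (C ^ 2 - c ^ 2) / ((1 + c ^ 2) * (1 + C ^ 2)))
        - 4 * q.im * ((1 - G) * g * ((1 - G₀) * G) * C₀ / (1 + C₀ ^ 2)
          - (1 - G) * g * ((1 - g) * γ) * e / (1 + e ^ 2)
          + (1 - G) * g * (1 - (1 - G) * g) * (c - C) * (1 - c * C) /
            ((1 + c ^ 2) * (1 + C ^ 2))) := by
  have h0 : (1 + C₀ ^ 2 : ℝ) ≠ 0 := by positivity
  have h1 : (1 + c ^ 2 : ℝ) ≠ 0 := by positivity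
  have h2 : (1 + C ^ 2 : ℝ) ≠ 0 := by positivity
  have h3 : (1 + e ^ 2 : ℝ) ≠ 0 := by positivity
  rw [gFlow, gFlow]
  field_simp
  ring

theorem theorem4 (μ : Measure ℂ) [IsFiniteMeasure μ] (hcircle : ∀ᵐ z ∂μ, ‖z‖ = 1)
    (hsupp : μ.support.Infinite) (q : ℂ) :
    let R : ℝ → ℕ → ℂ[X] := fun t n => normalizedKernel (modifiedMeasure μ q t) n
    let c : ℕ → ℝ → ℝ := fun n t => cCoeff (modifiedMeasure μ q t) n
    let d : ℕ → ℝ → ℝ := fun n t => dCoeff (modifiedMeasure μ q t) n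
    -- up to the displayed constant, `R_n` is the monic L-orthogonal polynomial of the functional
    (∀ (t : ℝ) (n : ℕ),
      IsMonicLOrthogonal (momentFunctional μ q t) n
        (C ((∏ k ∈ Finset.Icc 1 n, (1 + Complex.I * (c k t : ℂ)))⁻¹) * R t n)) ∧
    -- the three term recurrence relation, and the uniqueness of its real coefficients
    (∀ t : ℝ, SatisfiesRecurrence (R t) (fun n => c n t) (fun n => d n t)) ∧
    (∀ (t : ℝ) (c' d' : ℕ → ℝ), SatisfiesRecurrence (R t) c' d' →
      (∀ n : ℕ, 1 ≤ n → c' n = c n t) ∧ (∀ n : ℕ, 2 ≤ n → d' n = d n t)) ∧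
    -- the lattice equations
    (∀ t : ℝ, c 0 t = 1 ∧ d 1 t = 0) ∧
    (∀ t : ℝ, HasDerivAt (c 1)
      (-4 * q.re * (d 2 t * (c 1 t + c 2 t) / (1 + c 2 t ^ 2))
        - 4 * q.im * (d 2 t * (1 - c 1 t * c 2 t) / (1 + c 2 t ^ 2))) t) ∧
    (∀ (n : ℕ), 2 ≤ n → ∀ t : ℝ, HasDerivAt (c n)
      (4 * q.re * (d n t * (c n t + c (n - 1) t) / (1 + c (n - 1) t ^ 2)
          - d (n + 1) t * (c n t + c (n + 1) t) / (1 + c (n + 1) t ^ 2))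
        + 4 * q.im * (d n t * (1 - c n t * c (n - 1) t) / (1 + c (n - 1) t ^ 2)
          - d (n + 1) t * (1 - c n t * c (n + 1) t) / (1 + c (n + 1) t ^ 2))) t) ∧
    (∀ (n : ℕ), 2 ≤ n → ∀ t : ℝ, HasDerivAt (d n)
      (4 * q.re * (d n t * d (n - 1) t / (1 + c (n - 2) t ^ 2)
          - d n t * d (n + 1) t / (1 + c (n + 1) t ^ 2)
          + d n t * (1 - d n t) * (c (n - 1) t ^ 2 - c n t ^ 2)
            / ((1 + c n t ^ 2) * (1 + c (n - 1) t ^ 2)))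
        - 4 * q.im * (d n t * d (n - 1) t * c (n - 2) t / (1 + c (n - 2) t ^ 2)
          - d n t * d (n + 1) t * c (n + 1) t / (1 + c (n + 1) t ^ 2)
          + d n t * (1 - d n t) * (c n t - c (n - 1) t) * (1 - c n t * c (n - 1) t)
            / ((1 + c n t ^ 2) * (1 + c (n - 1) t ^ 2)))) t) := by
  intro R c d
  have hfin := isFiniteMeasure_modifiedMeasure hcircle q
  have hcν := ae_circle_modifiedMeasure hcircle q
  have hsν := support_modifiedMeasure_infinite hsupp q
  refine ⟨fun t n => ?_, fun t => satisfiesRecurrence_normalizedKernel (hcν t) (hsν t),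
    fun t c' d' h => satisfiesRecurrence_normalizedKernel_unique (hcν t) (hsν t) h,
    fun t => ⟨rfl, rfl⟩, fun t => ?_, fun n hn t => ?_, fun n hn t => ?_⟩
  · rw [momentFunctional_eq hcircle q t]
    exact isMonicLOrthogonal_normalizedKernel (hcν t) (hsν t) n
  · refine (hasDerivAt_cCoeff_gParam_one hcircle hsupp q t).1.congr_deriv ?_
    simp only [cFlow, c, d, dCoeff]
    ring
  · obtain ⟨m, rfl⟩ : ∃ m, n = m + 2 := ⟨n - 2, by omega⟩
    exact (hasDerivAt_cCoeff_gParam_add_two hcircle hsupp q m t).1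
  · obtain ⟨m, rfl⟩ : ∃ m, n = m + 2 := ⟨n - 2, by omega⟩
    have h2 := (hasDerivAt_cCoeff_gParam_add_two hcircle hsupp q m t).2
    -- `d_2` involves `g_1`, which obeys the first equation; there `d_1 = 0` absorbs `c_0`
    rcases m with _ | m
    · have h1 := (hasDerivAt_cCoeff_gParam_one hcircle hsupp q t).2
      refine ((h1.const_sub 1).mul h2).congr_deriv ((dFlow_eq ..).trans ?_)
      simp [c, d, dCoeff]
    · have h1 := (hasDerivAt_cCoeff_gParam_add_two hcircle hsupp q m t).2
      exact ((h1.const_sub 1).mul h2).congr_deriv (dFlow_eq ..)
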